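/- Let $d\ge 2$ and $L\ge 1$ be integers and let $\Lambda=(\mathbb Z/L\mathbb Z)^d$ be the periodic $d$-dimensional hypercubic lattice with primitive translation vectors $\vec e_1,\dots,\vec e_d$. On the Hilbert space $\bigotimes_{\vec r\in\Lambda}\mathbb C^2$ consider the mixed-field Ising Hamiltonian $$H=\sum_{\vec r\in\Lambda}\Bigl(\sum_{\mu=1}^{d}J^{\mu}Z_{\vec r}Z_{\vec r+\vec e_\mu}+h^xX_{\vec r}+h^zZ_{\vec r}\Bigr),$$ where $X_{\vec r},Y_{\vec r},Z_{\vec r}$ are the Pauli operators on site $\vec r$, and $J^1,\dots,J^d,h^x,h^z\in\mathbb R$. A Pauli product is an operator $\prod_{\vec r\in\Lambda}A_{\vec r}$ with each $A_{\vec r}\in\{I_{\vec r},X_{\vec r},Y_{\vec r},Z_{\vec r}\}$; its support is the set of $\vec r$ with $A_{\vec r}\ne I_{\vec r}$. It is an $(\ell_1,\dots,\ell_d)$-support operator if the smallest rectangular cuboid $\prod_{\mu}\{r_\mu,r_\mu+1,\dots,r_\mu+\ell_\mu-1\}\subset\Lambda$ (coordinates modulo $L$, all $\ell_\mu\ge 1$)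 containing its support has side lengths $\ell_1,\dots,\ell_d$; the identity $I$ counts as a $(1,\dots,1)$-support operator. An operator $Q$ with $[Q,H]=0$ is a $(k_1,\dots,k_d)$-local conserved quantity if, in the expansion of $Q$ in Pauli products, for every $\mu$ the maximum of $\ell_\mu$ over the Pauli products with nonzero coefficient exists and equals $k_\mu$. Suppose that $J^\mu\neq 0$ for all $\mu$ and $h^x\ne 0$, while $h^z$ is arbitrary. Let $k_1,\dots,k_d\in\{1,\dots,L\}$ and assume that one of them, $k_{\mu^*}$, satisfies $k_{\mu^*}\le L/2$. Then: 1. if $3\le k_{\mu^*}\le L/2$, there is no $(k_1,\dots,k_d)$-local conserved quantity; 2. if $k_{\mu^*}\le 2$, every $(k_1,\dots,k_d)$-local conserved quantity is of the form $aH+bI$ with $a,b\in\mathbb C$. Moreover, $H$ itself is a $(2,\dots,2)$-local conserved quantity. -/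

import Mathlib

namespace IsingLattice

/-- The four single-site Pauli labels `I, X, Y, Z`. -/
inductive Pauli
  | I
  | X
  | Y
  | Z
  deriving DecidableEq

instance : Fintype Pauli where
  elems := {Pauli.I, Pauli.X, Pauli.Y, Pauli.Z}
  complete := by intro a; cases a <;> decide

/-- The 2 × 2 Pauli matrices. -/
def Pauli.toMatrix : Pauli → Matrix (Fin 2) (Fin 2) ℂ
  | .I => 1
  | .X => !![0, 1; 1, 0]
  | .Y => !![0, -Complex.I; Complex.I, 0]
  | .Z => !![1, 0; 0, -1]

/-- Sites of the `d`-dimensional hypercubic lattice of side length `L` with periodic boundary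
conditions. -/
abbrev Site (d L : ℕ) : Type := Fin d → ZMod L

/-- Operators on the Hilbert space `⨂_{r} ℂ²` of spin-1/2 degrees of freedom on the lattice, as
matrices in the product basis labelled by the configurations `Site d L → Fin 2`. -/
abbrev Operator (d L : ℕ) : Type := Matrix (Site d L → Fin 2) (Site d L → Fin 2) ℂ

/-- A Pauli string: a choice of `I, X, Y, Z` on every site. -/
abbrev PauliString (d L : ℕ) : Type := Site d L → Pauli

/-- The primitive translation vector in direction `μ`. -/
def unitVec {d L : ℕ} (μ : Fin d) : Site d L := Pi.single μ 1

/-- The Pauli product `∏_r A_r` of a Pauli string `A`, i.e. the tensor product over all sites of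
the single-site Pauli matrices. -/
def pauliProduct {d L : ℕ} [NeZero L] (A : PauliString d L) : Operator d L :=
  Matrix.of fun s t => ∏ r, (A r).toMatrix (s r) (t r)

/-- The Pauli operator `a` acting on site `r` (and the identity on all other sites). -/
def onSite {d L : ℕ} [NeZero L] (a : Pauli) (r : Site d L) : Operator d L :=
  pauliProduct (Function.update (fun _ => Pauli.I) r a)

/-- The mixed-field Ising Hamiltonian
`H = ∑_r (∑_μ J^μ Z_r Z_{r+e_μ} + h^x X_r + h^z Z_r)` with periodic boundary conditions. -/
noncomputable def hamiltonian {d L : ℕ} [NeZero L] (J : Fin d → ℝ) (hx hz : ℝ) :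
    Operator d L :=
  ∑ r : Site d L,
    ((∑ μ : Fin d, (J μ : ℂ) • (onSite Pauli.Z r * onSite Pauli.Z (r + unitVec μ)))
      + (hx : ℂ) • onSite Pauli.X r + (hz : ℂ) • onSite Pauli.Z r)

/-- The support of a Pauli string: the sites where it is not the identity. -/
def PauliString.support {d L : ℕ} (A : PauliString d L) : Set (Site d L) :=
  {p | A p ≠ Pauli.I}

/-- The rectangular cuboid `∏_μ {r_μ, …, r_μ + ℓ_μ - 1}` of the periodic lattice. -/
def cuboid {d L : ℕ} (r : Site d L) (ℓ : Fin d → ℕ) : Set (Site d L) :=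
  {p | ∀ μ, ∃ j : ℕ, j < ℓ μ ∧ p μ = r μ + (j : ZMod L)}

/-- `A` is an `(ℓ_1, …, ℓ_d)`-support operator: `ℓ` are the side lengths (at least `1`) of the
smallest rectangular cuboid containing its support. Sides in different directions can be
minimized independently, so there is always exactly one such `ℓ` (`existsUnique_isSupport`). The
identity, whose support is empty, is a `(1, …, 1)`-support operator. -/
def IsSupport {d L : ℕ} (ℓ : Fin d → ℕ) (A : PauliString d L) : Prop :=
  IsLeast {m : Fin d → ℕ | (∀ μ, 1 ≤ m μ) ∧ ∃ r : Site d L, A.support ⊆ cuboid r m} ℓ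

theorem existsUnique_isSupport {d L : ℕ} [NeZero L] (A : PauliString d L) :
    ∃! ℓ : Fin d → ℕ, IsSupport ℓ A := by
  classical
  have hex : ∀ μ : Fin d, ∃ m : ℕ, 1 ≤ m ∧ ∃ a : ZMod L, ∀ p ∈ A.support,
      ∃ j : ℕ, j < m ∧ p μ = a + (j : ZMod L) := fun μ =>
    ⟨L, Nat.one_le_iff_ne_zero.2 (NeZero.ne L), 0, fun p _ =>
      ⟨(p μ).val, ZMod.val_lt _, by simp⟩⟩
  refine ⟨fun μ => Nat.find (hex μ), ⟨⟨fun μ => (Nat.find_spec (hex μ)).1, ?_⟩, ?_⟩,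
    fun ℓ hℓ => hℓ.unique ⟨⟨fun μ => (Nat.find_spec (hex μ)).1, ?_⟩, ?_⟩⟩
  · choose r hr using fun μ => (Nat.find_spec (hex μ)).2
    exact ⟨r, fun p hp μ => hr μ p hp⟩
  · rintro m ⟨hm, r, hr⟩ μ
    exact Nat.find_min' (hex μ) ⟨hm μ, r μ, fun p hp => hr hp μ⟩
  · choose r hr using fun μ => (Nat.find_spec (hex μ)).2
    exact ⟨r, fun p hp μ => hr μ p hp⟩
  · rintro m ⟨hm, r, hr⟩ μ
    exact Nat.find_min' (hex μ) ⟨hm μ, r μ, fun p hp => hr hp μ⟩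

/-- `Q` is a `(k_1, …, k_d)`-local conserved quantity of `H`: it commutes with `H`, and in its
expansion in Pauli products the largest side length in direction `μ` among the
terms with nonzero coefficient is exactly `k_μ`, for every `μ`. -/
def IsLocalConserved {d L : ℕ} [NeZero L] (H : Operator d L) (k : Fin d → ℕ)
    (Q : Operator d L) : Prop :=
  Commute Q H ∧
    ∃ c : PauliString d L → ℂ, Q = ∑ A, c A • pauliProduct A ∧
      ∀ μ, IsGreatest
        {m : ℕ | ∃ (A : PauliString d L) (ℓ : Fin d → ℕ), c A ≠ 0 ∧ IsSupport ℓ A ∧ ℓ μ = m}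
        (k μ)

end IsingLattice

/-! Comparing coefficients in `[Q, H] = 0` gives one linear equation for each Pauli string, relating
the coefficients of the strings obtained from it by multiplication with an anticommuting term of
`H`. Cut the lattice into layers perpendicular to the direction in which `2 * k ≤ L`, and measure
strings by their width in layers, at most `k`; the bound on `k` keeps windows from wrapping around.
The equation of a string that is slightly too wide, or of maximal width with an unusual shape, has
very few terms.

Take a maximal string with `X` or `Y` in its last layer and multiply it by the bond sticking out of
that end. Only the bond deleting the entire first layer can compensate, so the first layer is a
single `Z` and the string can be moved one layer forward (`left_end`, `shift_of_right_mem`).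
Iterating the motion shows that the string is a straight line `Z X ⋯ X Y` (`line_of_shift`,
`eq_line_of_right_mem`). Up to sign, all these lines and their mirror images on a given line have
one coefficient `β`.

Dimension at least two enters through a bond of strength `W ≠ 0` inside a layer. Multiplying the
lines by this bond and sliding them across its base site `y` gives a chain of equations that
telescopes to `(2k - 2) W β = 0` (`left_line_eq_zero`). Hence maximal strings end in `Z` on both
sides (`EndFree`). The same strategy then makes them lines `Z X ⋯ X Z` with coefficient `ζ`, tied to
lines `Y X ⋯ X Y` of width `k - 1`, and for `k ≥ 3` a second chain yields `(2k - 3) hx W ζ = 0`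
(`line_eq_zero`). So width `k` is not attained. In one dimension there is no in-layer bond, in
accordance with the integrable transverse-field chain.

For `k = 2` the equations force all coefficients of single `X` operators to agree. Subtracting a
multiple of `H` removes them, the width drops to one (`narrow_of_two`), and width one leaves only
the identity (`eq_zero_of_width_one`). -/

open scoped symmDiff

/-! ### The layered commutation equations and the transport of maximal strings. -/

namespace IsingLattice

/-- A Pauli string is encoded by the set `u` of its `X`/`Y` sites and the set `v` of its `Y`/`Z`
sites. `LayeredSolution` says that the coefficients `c u v` solve the commutation equations with a
Hamiltonian `∑ T, w T • ∏ t ∈ T, Z t + hx • ∑ t, X t`, that its `Z`-terms live on single sites,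
bonds `{t, t + e}` of strength `J` between consecutive layers, or pairs within a layer, and that
every string with nonzero coefficient fits into `k ≤ L / 2` consecutive layers. -/
structure LayeredSolution {V : Type*} [AddCommGroup V] [Fintype V] [DecidableEq V] {L : ℕ}
    (lay : V →+ ZMod L) (e : V) (J hx : ℂ) (w : Finset V → ℂ) (k : ℕ)
    (c : Finset V → Finset V → ℂ) : Prop where
  hx_ne : hx ≠ 0
  J_ne : J ≠ 0
  lay_e : lay e = 1
  nsmul_e : L • e = 0
  w_cases : ∀ T, w T ≠ 0 → (∃ t, T = {t}) ∨ (∃ t, T = {t, t + e}) ∨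
    ∃ a b, a ≠ b ∧ lay a = lay b ∧ T = {a, b}
  w_bond : ∀ t, w {t, t + e} = J
  eqn : ∀ u v, hx * ∑ t ∈ v, (if t ∈ u then 1 else -1) * c (u ∆ {t}) v +
    ∑ T, (if (T ∩ u).card = 1 then w T * (if Disjoint (T ∩ u) v then 1 else -1) * c u (v ∆ T)
      else 0) = 0
  width : ∀ u v, c u v ≠ 0 → ∃ x₀ : ZMod L, ∀ t ∈ u ∪ v, ∃ j : ℕ, j < k ∧ lay t = x₀ + j
  k_pos : 1 ≤ k
  two_k_le : 2 * k ≤ L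

namespace LayeredSolution

/-- The contribution of a pair term to the commutation equation. -/
theorem zterm_pair {V : Type*} [DecidableEq V] {w : Finset V → ℂ} {c : Finset V → Finset V → ℂ}
    {u v : Finset V} {a b : V} (ha : a ∈ u) (hb : b ∉ u) :
    (if (({a, b} : Finset V) ∩ u).card = 1 then
      w {a, b} * (if Disjoint (({a, b} : Finset V) ∩ u) v then 1 else -1) * c u (v ∆ {a, b})
      else 0) = w {a, b} * (if a ∈ v then -1 else 1) * c u (v ∆ {a, b}) := by
  have : ({a, b} : Finset V) ∩ u = {a} := by
    ext x; simp only [Finset.mem_inter, Finset.mem_insert, Finset.mem_singleton]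
    constructor
    · rintro ⟨rfl | rfl, h⟩
      · rfl
      · exact absurd h hb
    · rintro rfl; exact ⟨Or.inl rfl, ha⟩
  simp only [this, Finset.card_singleton, if_true, Finset.disjoint_singleton_left]
  by_cases h : a ∈ v <;> simp [h]

variable {V : Type*} [AddCommGroup V] [Fintype V] [DecidableEq V] {L : ℕ}
  {lay : V →+ ZMod L} {e : V} {J hx : ℂ} {w : Finset V → ℂ} {k : ℕ}
  {c : Finset V → Finset V → ℂ}

theorem natCast_inj {m n : ℕ} (hm : m < L) (hn : n < L) (h : (m : ZMod L) = n) : m = n := by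
  have := (ZMod.natCast_eq_natCast_iff' m n L).1 h
  rwa [Nat.mod_eq_of_lt hm, Nat.mod_eq_of_lt hn] at this

theorem intCast_inj {m n : ℤ} (h₁ : m - n < L) (h₂ : n - m < L) (h : (m : ZMod L) = n) :
    m = n := by
  have h3 := (ZMod.intCast_eq_intCast_iff_dvd_sub m n L).1 h
  obtain ⟨q, hq⟩ := h3
  have : q = 0 := by
    by_contra hq0
    rcases lt_or_gt_of_ne hq0 with h | h
    · nlinarith
    · nlinarith
  subst this; linarith

theorem lay_ne {x : ZMod L} {n : ℕ} (h0 : 0 < n) (hn : n < L) : x ≠ x + n := by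
  intro h
  have : (n : ZMod L) = (0 : ℕ) := by simpa using h.symm
  have := natCast_inj hn (by omega) this
  omega

/-- Reflection of the layers. -/
theorem reflect (S : LayeredSolution lay e J hx w k c) :
    LayeredSolution (-lay) (-e) J hx w k c where
  hx_ne := S.hx_ne
  J_ne := S.J_ne
  lay_e := by simp [S.lay_e]
  nsmul_e := by simp [S.nsmul_e]
  w_cases T hT := by
    rcases S.w_cases T hT with h | ⟨t, rfl⟩ | ⟨a, b, h1, h2, h3⟩
    · exact Or.inl h
    · exact Or.inr (Or.inl ⟨t + e, by rw [add_neg_cancel_right, Finset.pair_comm]⟩)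
    · exact Or.inr (Or.inr ⟨a, b, h1, by simp [h2], h3⟩)
  w_bond t := by
    have := S.w_bond (t + -e)
    rwa [neg_add_cancel_right, Finset.pair_comm] at this
  eqn := S.eqn
  width u v h := by
    obtain ⟨x, hx⟩ := S.width u v h
    have hk := S.k_pos
    refine ⟨-(x + (k - 1 : ℕ)), fun t ht => ?_⟩
    obtain ⟨j, hj, h⟩ := hx t ht
    refine ⟨k - 1 - j, by omega, ?_⟩
    have h3 : ((k - 1 : ℕ) : ZMod L) = (k - 1 - j : ℕ) + j := by
      rw [← Nat.cast_add]; congr 1; omega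
    rw [AddMonoidHom.neg_apply, h, h3]; ring
  k_pos := S.k_pos
  two_k_le := S.two_k_le

/-- A string touching two layers at distance `k - 1` lies between these layers. -/
theorem box (S : LayeredSolution lay e J hx w k c)
    {u v : Finset V} (hc : c u v ≠ 0) {t₀ t₁ t : V} (h₀ : t₀ ∈ u ∪ v) (h₁ : t₁ ∈ u ∪ v)
    (h : lay t₁ + 1 = lay t₀ + k) (ht : t ∈ u ∪ v) : ∃ j : ℕ, j < k ∧ lay t = lay t₀ + j := by
  obtain ⟨x, hx⟩ := S.width u v hc
  have hL := S.two_k_le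
  obtain ⟨a, ha, ha'⟩ := hx t₀ h₀
  obtain ⟨b, hb, hb'⟩ := hx t₁ h₁
  obtain ⟨j, hj, hj'⟩ := hx t ht
  -- Both sides are below `L` because `2 * k ≤ L`, so the congruence is an equality in `ℕ`; since `b
  -- + 1 ≤ k`, it forces `a = 0`.
  have : ((b + 1 : ℕ) : ZMod L) = (a + k : ℕ) := by
    rw [ha', hb'] at h; push_cast; linear_combination h
  have := natCast_inj (by omega) (by omega) this
  have : a = 0 := by omega
  subst this
  exact ⟨j, hj, by simp [ha', hj']⟩

theorem box_lt (S : LayeredSolution lay e J hx w k c)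
    {u v : Finset V} (hc : c u v ≠ 0) {t₀ t₁ t : V} (h₀ : t₀ ∈ u ∪ v)
    (h₁ : t₁ ∈ u ∪ v) (h : lay t₁ + 1 = lay t₀ + k) (ht : t ∈ u ∪ v) {n : ℕ} (hn : n < L)
    (hl : lay t = lay t₀ + n) : n < k := by
  obtain ⟨j, hj, hj'⟩ := S.box hc h₀ h₁ h ht
  have hL := S.two_k_le
  have : (n : ZMod L) = j := by rw [hl] at hj'; simpa using hj'
  have := natCast_inj hn (by omega) this
  omega

/-- A string touching two layers at distance `k` has coefficient zero. -/
theorem far (S : LayeredSolution lay e J hx w k c)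
    {u v : Finset V} (hc : c u v ≠ 0) {t₀ t₁ : V} (h₀ : t₀ ∈ u ∪ v) (h₁ : t₁ ∈ u ∪ v)
    (h : lay t₁ = lay t₀ + k) : False := by
  obtain ⟨x, hx⟩ := S.width u v hc
  have hL := S.two_k_le
  obtain ⟨a, ha, ha'⟩ := hx t₀ h₀
  obtain ⟨b, hb, hb'⟩ := hx t₁ h₁
  have : (b : ZMod L) = (a + k : ℕ) := by
    rw [ha', hb'] at h; push_cast; linear_combination h
  have := natCast_inj (by omega) (by omega) this
  omega

/-- The shape of a `Z`-term that anticommutes with a string. -/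
theorem term_cases (S : LayeredSolution lay e J hx w k c)
    {T u : Finset V} (hT : w T ≠ 0) (hu : (T ∩ u).card = 1) :
    (∃ a ∈ u, T = {a}) ∨ ∃ a b, a ∈ u ∧ b ∉ u ∧ T = {a, b} ∧
      (lay b = lay a ∨ b = a + e ∨ a = b + e) := by
  obtain ⟨a, ha⟩ := Finset.card_eq_one.1 hu
  have haT : a ∈ T ∩ u := by simp [ha]
  have hau := (Finset.mem_inter.1 haT).2
  have haT := (Finset.mem_inter.1 haT).1
  have key : ∀ b ∈ T, b ≠ a → b ∉ u := fun b hb hne hbu => hne <| by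
    have : b ∈ T ∩ u := Finset.mem_inter.2 ⟨hb, hbu⟩
    simpa [ha] using this
  rcases S.w_cases T hT with ⟨t, rfl⟩ | ⟨t, rfl⟩ | ⟨x, y, hne, hl, rfl⟩
  · left; exact ⟨t, by simp at haT; simpa [haT] using hau, rfl⟩
  · by_cases hte : t = t + e
    · left; exact ⟨a, hau, by simp [← hte] at haT ⊢; exact haT.symm⟩
    right
    simp only [Finset.mem_insert, Finset.mem_singleton] at haT
    rcases haT with rfl | rfl
    · exact ⟨a, a + e, hau, key _ (by simp) (Ne.symm hte), rfl, by simp⟩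
    · exact ⟨t + e, t, hau, key _ (by simp) hte, Finset.pair_comm _ _, by simp⟩
  · right
    simp only [Finset.mem_insert, Finset.mem_singleton] at haT
    rcases haT with rfl | rfl
    · exact ⟨a, y, hau, key _ (by simp) (Ne.symm hne), rfl, by simp [hl]⟩
    · exact ⟨a, x, hau, key _ (by simp) hne, Finset.pair_comm _ _, by simp [hl]⟩

/-- A site of a string survives a `Z`-term unless the term is a pair joining it to a site in `u`. -/
theorem mem_or_removed (S : LayeredSolution lay e J hx w k c)
    {T u v : Finset V} (hT : w T ≠ 0) (hu : (T ∩ u).card = 1) {t : V}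
    (ht : t ∈ u ∪ v) : t ∈ u ∪ v ∆ T ∨ ∃ a ∈ u, t ∉ u ∧ t ∈ v ∧ T = {a, t} ∧
      (lay t = lay a ∨ t = a + e ∨ a = t + e) := by
  by_cases htu : t ∈ u
  · left; exact Finset.mem_union_left _ htu
  have htv : t ∈ v := by simpa [htu] using ht
  rcases S.term_cases hT hu with ⟨a, ha, rfl⟩ | ⟨a, b, ha, hb, rfl, h⟩
  · left
    have : t ≠ a := fun h => htu (h ▸ ha)
    simp [Finset.mem_symmDiff, htv, this]
  · by_cases htb : t = b
    · subst htb; right; exact ⟨a, ha, htu, htv, rfl, h⟩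
    · left
      have : t ≠ a := fun h => htu (h ▸ ha)
      simp [Finset.mem_symmDiff, htv, this, htb]

/-- The commutation equation when all but selected terms vanish. -/
theorem eqn_of_vanish (S : LayeredSolution lay e J hx w k c)
    {u v : Finset V} (X : Finset V) (Z : Finset (Finset V)) (hXv : X ⊆ v)
    (hX : ∀ t ∈ v, t ∉ X → c (u ∆ {t}) v = 0)
    (hZ : ∀ T, w T ≠ 0 → (T ∩ u).card = 1 → T ∉ Z → c u (v ∆ T) = 0) :
    hx * ∑ t ∈ X, (if t ∈ u then 1 else -1) * c (u ∆ {t}) v +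
    ∑ T ∈ Z, (if (T ∩ u).card = 1 then
      w T * (if Disjoint (T ∩ u) v then 1 else -1) * c u (v ∆ T) else 0) = 0 := by
  refine Eq.trans ?_ (S.eqn u v)
  congr 1
  · congr 1
    exact Finset.sum_subset hXv fun t ht htX => by rw [hX t ht htX, mul_zero]
  · refine Finset.sum_subset (Finset.subset_univ Z) fun T _ hTZ => ?_
    by_cases hw : w T = 0
    · simp [hw]
    by_cases h : (T ∩ u).card = 1
    · rw [if_pos h, hZ T hw h hTZ, mul_zero]
    · rw [if_neg h]

/-- A string of nonzero coefficient that anticommutes with a pair term of nonzero strength leads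
to a second string of nonzero coefficient. -/
theorem exists_other_of_pair (S : LayeredSolution lay e J hx w k c)
    {u v : Finset V} (hc : c u v ≠ 0) {a b : V} (ha : a ∈ u)
    (hb : b ∉ u) (hw : w {a, b} ≠ 0) :
    (∃ t ∈ v ∆ {a, b}, c (u ∆ {t}) (v ∆ {a, b}) ≠ 0) ∨
    ∃ T, w T ≠ 0 ∧ (T ∩ u).card = 1 ∧ T ≠ {a, b} ∧ c u (v ∆ {a, b} ∆ T) ≠ 0 := by
  by_contra! hcon
  have := S.eqn_of_vanish (u := u) (v := v ∆ {a, b}) ∅ {{a, b}} (by simp)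
    (fun t ht _ => hcon.1 t ht) (fun T h1 h2 h3 => hcon.2 T h1 h2 (by simpa using h3))
  rw [Finset.sum_empty, Finset.sum_singleton, zterm_pair ha hb, symmDiff_symmDiff_cancel_right]
    at this
  split_ifs at this <;> simp [hw, hc] at this

/-- The coefficient `c u v` enters the equation of `(u ∆ {r}, v)` with prefactor `± hx ≠ 0`, so
another term has to cancel it. -/
theorem exists_other_of_site (S : LayeredSolution lay e J hx w k c)
    {u v : Finset V} (hc : c u v ≠ 0) {r : V} (hr : r ∈ v) :
    (∃ t ∈ v, t ≠ r ∧ c (u ∆ {r} ∆ {t}) v ≠ 0) ∨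
    ∃ T, w T ≠ 0 ∧ (T ∩ (u ∆ {r})).card = 1 ∧ c (u ∆ {r}) (v ∆ T) ≠ 0 := by
  by_contra! hcon
  have := S.eqn_of_vanish (u := u ∆ {r}) (v := v) {r} ∅ (by simpa using hr)
    (fun t ht h => hcon.1 t ht (by simpa using h)) (fun T h1 h2 _ => hcon.2 T h1 h2)
  rw [Finset.sum_empty, Finset.sum_singleton, symmDiff_symmDiff_cancel_right] at this
  split_ifs at this <;> simp [hc, S.hx_ne] at this

/-- If the last layer of a string of maximal width contains an `X` or `Y`, then its first layer
is a single `Z`, followed by an `X` or `Y`, and the string can be moved by one layer. -/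
theorem left_end (S : LayeredSolution lay e J hx w k c) (hk : 2 ≤ k)
    {u v : Finset V} (hc : c u v ≠ 0) {s r : V} (hs : s ∈ u ∪ v) (hr : r ∈ u)
    (hl : lay r + 1 = lay s + k) :
    s ∉ u ∧ s ∈ v ∧ (∀ t ∈ u ∪ v, lay t = lay s → t = s) ∧ s + e ∈ u ∧
      c u (v ∆ {r, r + e} ∆ {s, s + e}) ≠ 0 := by
  have hL := S.two_k_le
  have hlr : lay (r + e) = lay s + k := by rw [map_add, S.lay_e, hl]
  have hr' : r ∈ u ∪ v := Finset.mem_union_left _ hr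
  have hre : r + e ∉ u ∪ v := fun h => S.far hc hs h hlr
  have hreu : r + e ∉ u := fun h => hre (Finset.mem_union_left _ h)
  have hrev : r + e ∉ v := fun h => hre (Finset.mem_union_right _ h)
  have hne : ∀ t, lay t = lay s → t ≠ r ∧ t ≠ r + e := by
    intro t ht
    constructor
    · rintro rfl
      have h1 : lay s + ((k - 1 : ℕ) : ZMod L) = lay s := by
        rw [Nat.cast_sub (by omega), Nat.cast_one]; linear_combination ht - hl
      exact lay_ne (n := k - 1) (by omega) (by omega) h1.symm
    · rintro rfl
      exact lay_ne (n := k) (by omega) (by omega) (ht.symm.trans hlr)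
  have hB : ∀ t ∈ u ∪ v, lay t = lay s → t ∈ u ∪ v ∆ {r, r + e} := by
    intro t ht htl
    have := hne t htl
    simp only [Finset.mem_union, Finset.mem_symmDiff, Finset.mem_insert,
      Finset.mem_singleton] at ht ⊢
    tauto
  have hreB : r + e ∈ v ∆ {r, r + e} := by simp [Finset.mem_symmDiff, hrev]
  -- The string `(u, v ∆ {r, r + e})` spans `k + 1` layers. An X-term leaves both extreme sites in
  -- the support, so only a Z-term that empties an extreme layer can compensate.
  rcases S.exists_other_of_pair hc hr hreu (by rw [S.w_bond]; exact S.J_ne) with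
    ⟨t, ht, hct⟩ | ⟨T, hT, hTu, hTne, hcT⟩
  · refine (S.far hct (t₀ := s) (t₁ := r + e) ?_ (Finset.mem_union_right _ hreB) hlr).elim
    have := hB s hs rfl
    simp only [Finset.mem_union] at this ⊢
    by_cases hst : s = t
    · right; rwa [hst]
    · rcases this with h | h
      · left; simp [Finset.mem_symmDiff, h, hst]
      · right; exact h
  · rcases S.mem_or_removed hT hTu (Finset.mem_union_right u hreB) with h1 | ⟨a, hau, _, _, hTa, h1⟩
    swap
    · exfalso
      -- A partner of `r + e` in its own layer is too far from `s`, one in the previous layer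
      -- reproduces the original bond, and one in the next layer lies outside the window.
      rcases h1 with h1 | h1 | h1
      · exact S.far hc hs (Finset.mem_union_left _ hau) (h1.symm.trans hlr)
      · rw [← add_right_cancel h1] at hTa; exact hTne hTa
      · have := S.box_lt hc hs hr' hl (Finset.mem_union_left _ hau) (n := k + 1) (by omega)
          (by rw [h1, map_add, hlr, S.lay_e]; push_cast; ring)
        omega
    have hgone : ∀ t ∈ u ∪ v, lay t = lay s → t ∉ u ∪ v ∆ {r, r + e} ∆ T := fun t _ htl h =>
      S.far hcT h h1 (by rw [hlr, htl])
    rcases S.mem_or_removed hT hTu (hB s hs rfl) with h2 | ⟨a, hau, hsu, hsv, hTa, h2⟩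
    · exact (hgone s hs rfl h2).elim
    have hsv' : s ∈ v := by
      have := hne s rfl
      simpa [Finset.mem_symmDiff, this.1, this.2] using hsv
    have ha : a = s + e := by
      rcases h2 with h2 | h2 | h2
      · exact (hgone a (Finset.mem_union_left _ hau) h2.symm (Finset.mem_union_left _ hau)).elim
      -- A partner one layer before `s` sits at offset `L - 1` from it, again outside the window.
      · have := S.box_lt hc hs hr' hl (Finset.mem_union_left _ hau) (n := L - 1) (by omega)
          (by rw [h2, map_add, S.lay_e, Nat.cast_sub (by omega)]; simp)
        omega
      · exact h2
    subst ha
    rw [Finset.pair_comm] at hTa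
    refine ⟨hsu, hsv', fun t ht htl => ?_, hau, hTa ▸ hcT⟩
    by_contra hts
    refine hgone t ht htl ?_
    have h3 := hB t ht htl
    have h4 : t ≠ s + e := by
      rintro rfl
      exact lay_ne (x := lay s) (n := 1) (by omega) (by omega)
        (by rw [Nat.cast_one, ← S.lay_e, ← map_add, htl])
    rcases Finset.mem_union.1 h3 with h | h
    · exact Finset.mem_union_left _ h
    · exact Finset.mem_union_right _ (Finset.mem_symmDiff.2 (Or.inl ⟨h, by simp [hTa, h4, hts]⟩))

theorem eq_zero_of_ends (S : LayeredSolution lay e J hx w k c) (hk : 2 ≤ k)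
    {u v : Finset V} {s r : V} (hs : s ∈ u) (hr : r ∈ u) (hl : lay r + 1 = lay s + k) :
    c u v = 0 := by
  by_contra hc
  exact (S.left_end hk hc (Finset.mem_union_left _ hs) hr hl).1 hs

/-- After the bond moves of `left_end` the new last site `r + e` carries a `Z`. If `X` acts on it,
both ends are `X` or `Y`, so by `eq_zero_of_ends` only the flip at `s + e` can compensate. The
outcome is a string of the original kind, one layer further. -/
theorem shift_of_right_mem (S : LayeredSolution lay e J hx w k c) (hk : 2 ≤ k)
    {u v : Finset V} (hc : c u v ≠ 0) {s r : V} (hs : s ∈ u ∪ v) (hr : r ∈ u)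
    (hl : lay r + 1 = lay s + k) :
    s + e ∈ v ∆ {r, r + e} ∆ {s, s + e} ∧
      c (u ∆ {r + e} ∆ {s + e}) (v ∆ {r, r + e} ∆ {s, s + e}) ≠ 0 := by
  have hL := S.two_k_le
  obtain ⟨hsu, hsv, huniq, hseu, hc'⟩ := S.left_end hk hc hs hr hl
  set v' := v ∆ {r, r + e} ∆ {s, s + e} with hv'
  have hlr : lay (r + e) = lay s + k := by rw [map_add, S.lay_e, hl]
  have hlr' : lay (r + e) + 1 = lay (s + e) + k := by
    rw [map_add, map_add, S.lay_e]; linear_combination hl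
  have hre : r + e ∉ u ∪ v := fun h => S.far hc hs h hlr
  have hreu : r + e ∉ u := fun h => hre (Finset.mem_union_left _ h)
  have hrev : r + e ∉ v := fun h => hre (Finset.mem_union_right _ h)
  have hse : s + e ≠ r + e := fun h => hreu (h ▸ hseu)
  have hrs : r + e ≠ s := by rintro rfl; exact hrev hsv
  have hrev' : r + e ∈ v' := by
    simp [hv', Finset.mem_symmDiff, hrev, hse.symm, hrs]
  have hreu' : r + e ∈ u ∆ {r + e} := by simp [Finset.mem_symmDiff, hreu]
  have hseu' : s + e ∈ u ∆ {r + e} := by simp [Finset.mem_symmDiff, hseu, hse]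
  rcases S.exists_other_of_site hc' hrev' with ⟨t, ht, htr, hct⟩ | ⟨T, hT, hTu, hcT⟩
  · by_cases hts : t = s + e
    · subst hts; exact ⟨ht, hct⟩
    · refine (hct (S.eq_zero_of_ends hk (s := s + e) (r := r + e) ?_ ?_ hlr')).elim
      · rw [Finset.mem_symmDiff]; left; exact ⟨hseu', by simpa using Ne.symm hts⟩
      · rw [Finset.mem_symmDiff]; left; exact ⟨hreu', by simpa using Ne.symm htr⟩
  · exact (hcT (S.eq_zero_of_ends hk hseu' hreu' hlr')).elim

/-- Strings that can be moved layer by layer are straight lines with `X` in the interior. -/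
theorem line_of_shift (S : LayeredSolution lay e J hx w k c) (hk : 2 ≤ k)
    (Φ : Finset V → Finset V → V → V → Prop)
    (hl : ∀ u v s r, Φ u v s r → lay r + 1 = lay s + k)
    (hfirst : ∀ u v s r, Φ u v s r → ∀ t ∈ u ∪ v, lay t = lay s + 1 → t = s + e)
    (hsnd : ∀ u v s r, Φ u v s r → 3 ≤ k → s + e ∈ u ∧ s + e ∉ v)
    (hmem : ∀ u v s r, Φ u v s r → r ∈ u ∪ v)
    (hnext : ∀ u v s r, Φ u v s r → ∃ u' v', Φ u' v' (s + e) (r + e) ∧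
      (3 ≤ k → r ∈ u') ∧ ∀ t, t ≠ s → t ≠ s + e → t ≠ r → t ≠ r + e →
        (t ∈ u' ↔ t ∈ u) ∧ (t ∈ v' ↔ t ∈ v))
    {u v : Finset V} {s r : V} (h : Φ u v s r) :
    r = s + (k - 1) • e ∧
    (∀ i : ℕ, 1 ≤ i → i + 1 ≤ k → ∀ t ∈ u ∪ v, lay t = lay s + i → t = s + i • e) ∧
    ∀ i : ℕ, 1 ≤ i → i + 2 ≤ k → s + i • e ∈ u ∧ s + i • e ∉ v := by
  have hL := S.two_k_le
  have hlayne : ∀ {u v s r}, Φ u v s r → ∀ i : ℕ, 2 ≤ i → i + 2 ≤ k → ∀ t,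
      lay t = lay s + i → t ≠ s ∧ t ≠ s + e ∧ t ≠ r ∧ t ≠ r + e := by
    intro u v s r h i h2 hik t ht
    have hr : lay r = lay s + ((k - 1 : ℕ) : ZMod L) := by
      rw [Nat.cast_sub (by omega), Nat.cast_one]; linear_combination hl _ _ _ _ h
    have key : ∀ n : ℕ, n < L → lay t = lay s + n → i = n := fun n hn h' => by
      refine natCast_inj (L := L) (by omega) hn ?_
      rw [ht] at h'; exact add_left_cancel h'
    refine ⟨?_, ?_, ?_, ?_⟩
    · rintro rfl; have := key 0 (by omega) (by simp); omega
    · rintro rfl; have := key 1 (by omega) (by simp [S.lay_e]); omega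
    · rintro rfl; have := key (k - 1) (by omega) hr; omega
    · rintro rfl
      have := key k (by omega) (by
        rw [map_add, hr, S.lay_e, Nat.cast_sub (by omega)]; push_cast; ring)
      omega
  have main : ∀ i : ℕ, 1 ≤ i → i + 2 ≤ k → ∀ u v s r, Φ u v s r →
      (∀ t ∈ u ∪ v, lay t = lay s + i → t = s + i • e) ∧ s + i • e ∈ u ∧ s + i • e ∉ v := by
    intro i hi
    induction i, hi using Nat.le_induction with
    | base =>
      intro hk3 u v s r h
      refine ⟨fun t ht htl => ?_, by simpa using hsnd u v s r h (by omega)⟩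
      simpa using hfirst u v s r h t ht (by simpa using htl)
    | succ i hi ih =>
      intro hik u v s r h
      -- Layer `i + 1` counted from `s` is layer `i` counted from `s + e` in the shifted string, and
      -- the shift alters only sites in layers `0`, `1`, `k - 1` and `k`.
      obtain ⟨u', v', h', -, heq⟩ := hnext u v s r h
      obtain ⟨h1, h2, h3⟩ := ih (by omega) u' v' (s + e) (r + e) h'
      have hadd : s + e + i • e = s + (i + 1) • e := by rw [succ_nsmul]; abel
      have hlay : lay (s + (i + 1) • e) = lay s + ((i + 1 : ℕ) : ZMod L) := by
        simp [S.lay_e]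
      rw [hadd] at h1 h2 h3
      have hiff : ∀ t, lay t = lay s + ((i + 1 : ℕ) : ZMod L) →
          (t ∈ u' ↔ t ∈ u) ∧ (t ∈ v' ↔ t ∈ v) := fun t ht => by
        obtain ⟨a1, a2, a3, a4⟩ := hlayne h (i + 1) (by omega) hik t ht
        exact heq t a1 a2 a3 a4
      refine ⟨fun t ht htl => h1 t ?_ ?_, (hiff _ hlay).1.1 h2, fun h => h3 ((hiff _ hlay).2.2 h)⟩
      · simpa [hiff t htl] using ht
      · rw [htl, map_add, S.lay_e]; push_cast; ring
  have hlast : r = s + (k - 1) • e ∧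
      ∀ t ∈ u ∪ v, lay t = lay s + ((k - 1 : ℕ) : ZMod L) → t = s + (k - 1) • e := by
    -- For `k = 2` the last layer is the one controlled by `hfirst`; otherwise it is an interior
    -- layer of the shifted string.
    rcases hk.eq_or_lt with rfl | hk3
    · have hr : lay r = lay s + 1 := by
        have := hl u v s r h
        push_cast at this
        linear_combination this
      exact ⟨by simpa using hfirst u v s r h r (hmem u v s r h) hr, fun t ht htl => by
        simpa using hfirst u v s r h t ht (by simpa using htl)⟩
    · obtain ⟨u', v', h', hru, heq⟩ := hnext u v s r h
      obtain ⟨h1, h2, h3⟩ := main (k - 2) (by omega) (by omega) u' v' (s + e) (r + e) h'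
      have hadd : s + e + (k - 2) • e = s + (k - 1) • e := by
        rw [show k - 1 = k - 2 + 1 by omega, succ_nsmul]; abel
      rw [hadd] at h1
      have hlay : ∀ t, lay t = lay s + ((k - 1 : ℕ) : ZMod L) →
          lay t = lay (s + e) + ((k - 2 : ℕ) : ZMod L) := fun t ht => by
        rw [ht, map_add, S.lay_e, show k - 1 = k - 2 + 1 by omega]; push_cast; ring
      have hr : lay r = lay s + ((k - 1 : ℕ) : ZMod L) := by
        rw [Nat.cast_sub (by omega), Nat.cast_one]; linear_combination hl _ _ _ _ h
      have hr' := h1 r (Finset.mem_union_left _ (hru hk3)) (hlay r hr)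
      refine ⟨hr', fun t ht htl => ?_⟩
      by_cases htr : t = r
      · rw [htr, hr']
      refine h1 t ?_ (hlay t htl)
      have key : ∀ n : ℕ, n < L → lay t = lay s + n → k - 1 = n := fun n hn h' => by
        refine natCast_inj (L := L) (by omega) hn ?_
        rw [htl] at h'; exact add_left_cancel h'
      have := heq t
        (by rintro rfl; have := key 0 (by omega) (by simp); omega)
        (by rintro rfl; have := key 1 (by omega) (by simp [S.lay_e]); omega) htr
        (by
          rintro rfl
          have := key k (by omega) (by
            rw [map_add, hr, S.lay_e, Nat.cast_sub (by omega)]; push_cast; ring)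
          omega)
      simpa [this] using ht
  refine ⟨hlast.1, fun i h1 h2 t ht htl => ?_, fun i h1 h2 => (main i h1 h2 u v s r h).2⟩
  rcases h2.eq_or_lt with rfl | h3
  · exact hlast.2 t ht htl
  · exact (main i h1 h3 u v s r h).1 t ht htl

end LayeredSolution

/-! ### Segments of a lattice line, indexed by integers. -/

/-- The sites `y + j • e` with `m ≤ j < n`. -/
noncomputable def seg {V : Type*} [AddCommGroup V] [DecidableEq V] (y e : V) (m n : ℤ) : Finset V :=
  (Finset.Ico m n).image fun j => y + j • e

theorem mem_seg {V : Type*} [AddCommGroup V] [DecidableEq V] {y e t : V} {m n : ℤ} :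
    t ∈ seg y e m n ↔ ∃ j, m ≤ j ∧ j < n ∧ t = y + j • e := by
  simp only [seg, Finset.mem_image, Finset.mem_Ico]
  exact ⟨fun ⟨j, h1, h2⟩ => ⟨j, h1.1, h1.2, h2.symm⟩, fun ⟨j, h1, h2, h3⟩ => ⟨j, ⟨h1, h2⟩, h3.symm⟩⟩

theorem seg_translate {V : Type*} [AddCommGroup V] [DecidableEq V] (y e : V) (p m n : ℤ) :
    seg (y + p • e) e m n = seg y e (p + m) (p + n) := by
  ext t
  simp only [mem_seg]
  constructor
  · rintro ⟨j, h1, h2, rfl⟩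
    exact ⟨p + j, by omega, by omega, by rw [add_smul]; abel⟩
  · rintro ⟨j, h1, h2, rfl⟩
    exact ⟨j - p, by omega, by omega, by rw [sub_smul]; abel⟩

/-- Reversing a half-open interval moves its open end to the other side, hence the offsets by one.
-/
theorem seg_neg {V : Type*} [AddCommGroup V] [DecidableEq V] (y e : V) (m n : ℤ) :
    seg y (-e) m n = seg y e (1 - n) (1 - m) := by
  ext t
  simp only [mem_seg]
  constructor
  · rintro ⟨j, h1, h2, rfl⟩
    exact ⟨-j, by omega, by omega, by simp⟩
  · rintro ⟨j, h1, h2, rfl⟩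
    exact ⟨-j, by omega, by omega, by simp⟩

namespace LayeredSolution

variable {V : Type*} [AddCommGroup V] [Fintype V] [DecidableEq V] {L : ℕ}
  {lay : V →+ ZMod L} {e : V} {J hx : ℂ} {w : Finset V → ℂ} {k : ℕ}
  {c : Finset V → Finset V → ℂ}

theorem lay_pt (S : LayeredSolution lay e J hx w k c) (y : V) (j : ℤ) :
    lay (y + j • e) = lay y + j := by
  simp [S.lay_e]

theorem pt_inj (S : LayeredSolution lay e J hx w k c) {y : V} {i j : ℤ} (h₁ : i - j < L)
    (h₂ : j - i < L) (h : y + i • e = y + j • e) : i = j := by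
  refine intCast_inj (L := L) h₁ h₂ ?_
  have := congrArg lay h
  rw [S.lay_pt, S.lay_pt] at this
  exact add_left_cancel this

/-- The bounds ensure that no index of the segment other than `i` is congruent to `i` modulo `L`, so
membership is decided by integer inequalities. -/
theorem pt_mem_seg (S : LayeredSolution lay e J hx w k c) {y : V} {i m n : ℤ}
    (h₁ : i - m < L) (h₂ : n - i ≤ L) : y + i • e ∈ seg y e m n ↔ m ≤ i ∧ i < n := by
  rw [mem_seg]
  constructor
  · rintro ⟨j, hm, hn, h⟩
    have := S.pt_inj (by omega) (by omega) h
    omega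
  · rintro ⟨h1, h2⟩
    exact ⟨i, h1, h2, rfl⟩

theorem ends_ne (S : LayeredSolution lay e J hx w k c) (hk : 2 ≤ k) {s r : V}
    (hl : lay r + 1 = lay s + k) : r + e ≠ s ∧ r + e ≠ s + e ∧ (3 ≤ k → r ≠ s + e) ∧
      r ≠ r + e ∧ s ≠ s + e ∧ r ≠ s := by
  have hL := S.two_k_le
  have hr : lay r = lay s + ((k - 1 : ℕ) : ZMod L) := by
    rw [Nat.cast_sub (by omega), Nat.cast_one]; linear_combination hl
  have key : ∀ m n : ℕ, m < L → n < L → lay s + m = lay s + n → m = n := fun m n hm hn h' =>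
    natCast_inj (L := L) hm hn (add_left_cancel h')
  have hre : lay (r + e) = lay s + (k : ℕ) := by rw [map_add, S.lay_e, hl]
  have hse : lay (s + e) = lay s + (1 : ℕ) := by rw [map_add, S.lay_e, Nat.cast_one]
  have hs : lay s = lay s + (0 : ℕ) := by simp
  refine ⟨fun h => ?_, fun h => ?_, fun h3 h => ?_, fun h => ?_, fun h => ?_, fun h => ?_⟩ <;>
    replace h := congrArg lay h
  · have := key k 0 (by omega) (by omega) (by rw [← hre, h]; exact hs); omega
  · have := key k 1 (by omega) (by omega) (by rw [← hre, h, hse]); omega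
  · have := key (k - 1) 1 (by omega) (by omega) (by rw [← hr, h, hse]); omega
  · have := key (k - 1) k (by omega) (by omega) (by rw [← hr, h, hre]); omega
  · have := key 1 0 (by omega) (by omega) (by rw [← hse, ← h]; exact hs); omega
  · have := key (k - 1) 0 (by omega) (by omega) (by rw [← hr, h]; exact hs); omega

/-! ### Shape of maximal strings with `X` or `Y` at an end. -/

/-- Maximal-width strings with `X` or `Y` in the last layer are lines `Z X ⋯ X Y`. -/
theorem eq_line_of_right_mem (S : LayeredSolution lay e J hx w k c) (hk : 2 ≤ k)
    {u v : Finset V} (hc : c u v ≠ 0) {s r : V} (hs : s ∈ u ∪ v) (hr : r ∈ u)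
    (hl : lay r + 1 = lay s + k) :
    u = seg s e 1 k ∧ v = {s, s + ((k : ℤ) - 1) • e} := by
  have hL := S.two_k_le
  let Φ : Finset V → Finset V → V → V → Prop := fun u v s r =>
    c u v ≠ 0 ∧ s ∈ u ∪ v ∧ r ∈ u ∧ lay r + 1 = lay s + k
  have hΦ : ∀ u v s r, Φ u v s r →
      Φ (u ∆ {r + e} ∆ {s + e}) (v ∆ {r, r + e} ∆ {s, s + e}) (s + e) (r + e) := by
    rintro u v s r ⟨hc, hs, hr, hl⟩
    obtain ⟨h1, h2⟩ := S.shift_of_right_mem hk hc hs hr hl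
    have hlr : lay (r + e) = lay s + k := by rw [map_add, S.lay_e, hl]
    have hre : r + e ∉ u := fun h => S.far hc hs (Finset.mem_union_left _ h) hlr
    refine ⟨h2, Finset.mem_union_right _ h1, ?_, ?_⟩
    · simp [Finset.mem_symmDiff, (S.ends_ne hk hl).2.1, hre]
    · rw [map_add, map_add, S.lay_e]; linear_combination hl
  have hv' : ∀ u v s r, Φ u v s r → s + e ∈ v ∆ {r, r + e} ∆ {s, s + e} := by
    rintro u v s r ⟨hc, hs, hr, hl⟩
    exact (S.shift_of_right_mem hk hc hs hr hl).1
  have hline := fun u v s r h => S.line_of_shift (u := u) (v := v) (s := s) (r := r) hk Φ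
    (fun u v s r h => h.2.2.2)
    (by
      rintro u v s r h t ht htl
      obtain ⟨hc, hs, hr, hl⟩ := h
      obtain ⟨hc', hs', hr', hl'⟩ := hΦ u v s r ⟨hc, hs, hr, hl⟩
      by_contra hts
      refine hts ((S.left_end hk hc' hs' hr' hl').2.2.1 t ?_ (by rw [htl, map_add, S.lay_e]))
      obtain ⟨a1, a2, a3, a4, a5, a6⟩ := S.ends_ne hk hl
      have htre : t ≠ r + e := by
        rintro rfl
        refine lay_ne (x := lay s + 1) (n := k - 1) (by omega) (by omega) ?_
        rw [map_add, S.lay_e, hl] at htl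
        rw [Nat.cast_sub (by omega)]
        push_cast; linear_combination -htl
      have hts0 : t ≠ s := by
        rintro rfl
        exact lay_ne (x := lay t) (n := 1) (by omega) (by omega) (by simpa using htl)
      rw [Finset.mem_union] at ht ⊢
      by_cases htr : t = r
      · subst htr; left; simp [Finset.mem_symmDiff, hr, htre, hts]
      · rcases ht with ht | ht
        · left; simp [Finset.mem_symmDiff, ht, htre, hts]
        · right; simp [Finset.mem_symmDiff, ht, htre, hts, htr, hts0])
    (by
      rintro u v s r h hk3
      have h1 := hv' u v s r h
      obtain ⟨hc, hs, hr, hl⟩ := h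
      obtain ⟨a1, a2, a3, a4, a5, a6⟩ := S.ends_ne hk hl
      refine ⟨(S.left_end hk hc hs hr hl).2.2.2.1, fun hv => ?_⟩
      simp [Finset.mem_symmDiff, hv, (a3 hk3).symm, a2.symm] at h1)
    (fun u v s r h => Finset.mem_union_left _ h.2.2.1)
    (by
      rintro u v s r h
      refine ⟨_, _, hΦ u v s r h, fun hk3 => ?_, fun t h1 h2 h3 h4 => ?_⟩
      · obtain ⟨hc, hs, hr, hl⟩ := h
        obtain ⟨a1, a2, a3, a4, a5, a6⟩ := S.ends_ne hk hl
        simp [Finset.mem_symmDiff, hr, a3 hk3, a4]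
      · simp [Finset.mem_symmDiff, h1, h2, h3, h4]) h
  obtain ⟨hreq, h1, h2⟩ := hline u v s r ⟨hc, hs, hr, hl⟩
  obtain ⟨hsu, hsv, huniq, hseu, -⟩ := S.left_end hk hc hs hr hl
  have hr' : r = s + ((k : ℤ) - 1) • e := by
    rw [hreq, ← natCast_zsmul, Nat.cast_sub (by omega), Nat.cast_one]
  -- For `k ≥ 3` the site `r` is interior to the shifted string and has no `Z` part there; the shift
  -- toggles that part once, so `r` carries `Y`. For `k = 2` it is the first site of the shifted
  -- string, has a `Z` part there, and is toggled twice.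
  have hrv : r ∈ v := by
    obtain ⟨a1, a2, a3, a4, a5, a6⟩ := S.ends_ne hk hl
    rcases hk.eq_or_lt with rfl | hk3
    · have h3 := hv' u v s r ⟨hc, hs, hr, hl⟩
      have h4 : s + e = r := by simpa using hreq.symm
      rw [h4] at h3
      simpa [Finset.mem_symmDiff, a4, a6] using h3
    · have h3 := ((hline _ _ _ _ (hΦ u v s r ⟨hc, hs, hr, hl⟩)).2.2 (k - 2) (by omega)
        (by omega)).2
      have h4 : s + e + (k - 2) • e = r := by
        rw [hreq, show k - 1 = k - 2 + 1 by omega, succ_nsmul]; abel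
      rw [h4] at h3
      simpa [Finset.mem_symmDiff, a3 hk3, a4, a6] using h3
  have hcov : ∀ t ∈ u ∪ v, t = s ∨ ∃ j : ℕ, 1 ≤ j ∧ j < k ∧ t = s + j • e := by
    intro t ht
    obtain ⟨j, hj, hjl⟩ := S.box hc hs (Finset.mem_union_left _ hr) hl ht
    rcases Nat.eq_zero_or_pos j with rfl | hj0
    · left; exact huniq t ht (by simpa using hjl)
    · right; exact ⟨j, hj0, hj, h1 j hj0 (by omega) t ht hjl⟩
  constructor
  · ext t
    rw [mem_seg]
    constructor
    · intro ht
      rcases hcov t (Finset.mem_union_left _ ht) with rfl | ⟨j, hj1, hj2, rfl⟩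
      · exact absurd ht hsu
      · exact ⟨j, by omega, by omega, by simp⟩
    · rintro ⟨j, hj1, hj2, rfl⟩
      lift j to ℕ using by omega
      rw [natCast_zsmul]
      rcases eq_or_ne j (k - 1) with rfl | hjk
      · rwa [← hreq]
      · exact (h2 j (by omega) (by omega)).1
  · rw [← hr']
    ext t
    simp only [Finset.mem_insert, Finset.mem_singleton]
    constructor
    · intro ht
      rcases hcov t (Finset.mem_union_right _ ht) with h | ⟨j, hj1, hj2, rfl⟩
      · exact Or.inl h
      · rcases eq_or_ne j (k - 1) with rfl | hjk
        · right; exact hreq.symm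
        · exact absurd ht (h2 j hj1 (by omega)).2
    · rintro (rfl | rfl)
      · exact hsv
      · exact hrv

/-- Positions are written relative to a base point `y`, so that different strings on one line can be
compared through integer indices. -/
theorem eq_line_of_pt_right (S : LayeredSolution lay e J hx w k c) (hk : 2 ≤ k)
    {u v : Finset V} (hc : c u v ≠ 0) {y r : V} {p : ℤ} (hs : y + p • e ∈ u ∪ v) (hr : r ∈ u)
    (hl : lay r + 1 = lay y + (p + k : ℤ)) :
    u = seg y e (p + 1) (p + k) ∧ v = {y + p • e, y + (p + k - 1) • e} := by
  have := S.eq_line_of_right_mem hk hc hs hr (by rw [hl, S.lay_pt]; push_cast; ring)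
  rw [seg_translate] at this
  refine ⟨this.1, ?_⟩
  rw [this.2]
  congr 2
  rw [add_assoc, ← add_smul]
  congr 2
  ring

/-- Maximal-width strings with `X` or `Y` in the first layer are lines `Y X ⋯ X Z`. -/
theorem eq_line_of_pt_left (S : LayeredSolution lay e J hx w k c) (hk : 2 ≤ k)
    {u v : Finset V} (hc : c u v ≠ 0) {y s : V} {p : ℤ} (hs : s ∈ u)
    (hr : y + (p + k - 1) • e ∈ u ∪ v) (hl : lay s = lay y + p) :
    u = seg y e p (p + k - 1) ∧ v = {y + p • e, y + (p + k - 1) • e} := by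
  -- Reflection sends index `j` to `-j`, so the window from `p` to `p + k - 1` starts at `-(p + k -
  -- 1)`.
  have := S.reflect.eq_line_of_pt_right hk hc (y := y) (p := -(p + k - 1)) (by rwa [neg_smul_neg]) hs
    (by simp [hl]; ring)
  rw [seg_neg] at this
  rw [this.1, this.2]
  constructor
  · congr 1 <;> ring
  · rw [Finset.pair_comm]
    congr 1
    · rw [smul_neg, ← neg_smul]; congr 2; ring
    · rw [smul_neg, ← neg_smul]; congr 3; ring

end LayeredSolution

/-! ### Linear equations along a line, and vanishing of `Z X ⋯ X Y` and `Y X ⋯ X Z`. -/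

theorem symmDiff_cancel_snd {V : Type*} [DecidableEq V] (A B C P : Finset V) :
    A ∆ B ∆ P ∆ (B ∆ C) = A ∆ C ∆ P := by
  rw [symmDiff_right_comm _ P, symmDiff_assoc A, symmDiff_symmDiff_cancel_left]

theorem symmDiff_cancel_fst {V : Type*} [DecidableEq V] (A B C P : Finset V) :
    A ∆ B ∆ P ∆ (A ∆ C) = C ∆ B ∆ P := by
  rw [symmDiff_comm A B, symmDiff_cancel_snd, symmDiff_comm B C]

theorem pair_eq_symmDiff {V : Type*} [DecidableEq V] {a b : V} (h : a ≠ b) :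
    ({a, b} : Finset V) = {a} ∆ {b} := by
  ext t
  simp only [Finset.mem_insert, Finset.mem_singleton, Finset.mem_symmDiff]
  constructor
  · rintro (rfl | rfl)
    · exact Or.inl ⟨rfl, h⟩
    · exact Or.inr ⟨rfl, h.symm⟩
  · rintro (h | h)
    · exact Or.inl h.1
    · exact Or.inr h.1

/-- The coefficient of the string with `X` on a segment of a line, multiplied by `Z` on two sites
of the line and on all sites of `P`. -/
noncomputable def lineCoeff {V : Type*} [AddCommGroup V] [DecidableEq V]
    (c : Finset V → Finset V → ℂ) (y e : V) (P : Finset V) (m n p q : ℤ) : ℂ :=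
  c (seg y e m n) ({y + p • e} ∆ {y + q • e} ∆ P)

theorem lineCoeff_neg {V : Type*} [AddCommGroup V] [DecidableEq V]
    (c : Finset V → Finset V → ℂ) (y e : V) (P : Finset V) (m n p q : ℤ) :
    lineCoeff c y (-e) P m n p q = lineCoeff c y e P (1 - n) (1 - m) (-q) (-p) := by
  rw [lineCoeff, lineCoeff, seg_neg, symmDiff_comm {y + p • -e}]
  simp

namespace LayeredSolution

variable {V : Type*} [AddCommGroup V] [Fintype V] [DecidableEq V] {L : ℕ}
  {lay : V →+ ZMod L} {e : V} {J hx : ℂ} {w : Finset V → ℂ} {k : ℕ}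
  {c : Finset V → Finset V → ℂ}

theorem seg_symmDiff_succ (S : LayeredSolution lay e J hx w k c) (y : V) {m n : ℤ} (h : m ≤ n)
    (hL : n - m < L) : seg y e m n ∆ {y + n • e} = seg y e m (n + 1) := by
  have hn : y + n • e ∉ seg y e m n := by
    rw [S.pt_mem_seg hL (by omega)]; omega
  ext t
  simp only [Finset.mem_symmDiff, Finset.mem_singleton]
  constructor
  · rintro (⟨h1, -⟩ | ⟨rfl, -⟩)
    · obtain ⟨j, hm, h2, rfl⟩ := mem_seg.1 h1
      exact mem_seg.2 ⟨j, hm, by omega, rfl⟩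
    · exact mem_seg.2 ⟨n, h, by omega, rfl⟩
  · intro ht
    obtain ⟨j, h1, h2, rfl⟩ := mem_seg.1 ht
    by_cases hj : j = n
    · subst hj; right; exact ⟨rfl, hn⟩
    · have : y + j • e ∈ seg y e m n := mem_seg.2 ⟨j, h1, by omega, rfl⟩
      left; exact ⟨this, fun h => hn (h ▸ this)⟩

theorem seg_symmDiff_pred (S : LayeredSolution lay e J hx w k c) (y : V) {m n : ℤ} (h : m < n)
    (hL : n - m ≤ L) : seg y e m n ∆ {y + (n - 1) • e} = seg y e m (n - 1) := by
  have := S.seg_symmDiff_succ y (m := m) (n := n - 1) (by omega) (by omega)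
  rw [sub_add_cancel] at this
  rw [← this, symmDiff_symmDiff_cancel_right]

theorem seg_symmDiff_left (S : LayeredSolution lay e J hx w k c) (y : V) {m n : ℤ} (h : m < n)
    (hL : n - m ≤ L) : seg y e m n ∆ {y + m • e} = seg y e (m + 1) n := by
  have := S.reflect.seg_symmDiff_pred y (m := 1 - n) (n := 1 - m) (by omega) (by omega)
  rw [seg_neg, seg_neg] at this
  simpa [add_comm] using this

theorem bond_ne (S : LayeredSolution lay e J hx w k c) (y : V) (i j : ℤ) (h : i ≠ j)
    (h1 : i - j < L) (h2 : j - i < L) : y + i • e ≠ y + j • e := fun h' =>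
  h (S.pt_inj h1 h2 h')

theorem w_pt (S : LayeredSolution lay e J hx w k c) (y : V) (i j : ℤ) (h : j = i + 1) :
    w {y + i • e, y + j • e} = J := by
  have := S.w_bond (y + i • e)
  rwa [show y + i • e + e = y + j • e by rw [h, add_smul, one_smul, add_assoc]] at this

theorem w_pt_swap (S : LayeredSolution lay e J hx w k c) (y : V) (i j : ℤ) (h : i = j + 1) :
    w {y + i • e, y + j • e} = J := by
  rw [Finset.pair_comm]; exact S.w_pt y j i h

/-- A `Z`-term that removes a site at the end of a segment is the bond into the segment. -/
theorem end_cases (S : LayeredSolution lay e J hx w k c) {T v : Finset V} {y : V} {m n q : ℤ}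
    (hT : w T ≠ 0) (hTu : (T ∩ seg y e m n).card = 1) (hq : y + q • e ∈ v)
    (hm : m - 1 ≤ q) (hn : q ≤ n) (hL : n - m + 1 < L) :
    y + q • e ∈ seg y e m n ∪ v ∆ T ∨ (q = m - 1 ∧ T = {y + m • e, y + (m - 1) • e}) ∨
      (q = n ∧ T = {y + (n - 1) • e, y + n • e}) := by
  rcases S.mem_or_removed hT hTu (Finset.mem_union_right _ hq) with h | ⟨a, ha, hqu, -, hTa, h⟩
  · exact Or.inl h
  right
  obtain ⟨j, h1, h2, rfl⟩ := mem_seg.1 ha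
  have hq' : ¬ (m ≤ q ∧ q < n) := fun h => hqu (mem_seg.2 ⟨q, h.1, h.2, rfl⟩)
  have hsucc : ∀ i : ℤ, y + i • e + e = y + (i + 1) • e := fun i => by
    rw [add_smul, one_smul, add_assoc]
  have h3 : q = j ∨ q = j + 1 ∨ j = q + 1 := by
    rcases h with h | h | h
    · rw [S.lay_pt, S.lay_pt] at h
      exact Or.inl (intCast_inj (by omega) (by omega) (add_left_cancel h))
    · rw [hsucc] at h
      exact Or.inr (Or.inl (S.pt_inj (by omega) (by omega) h))
    · rw [hsucc] at h
      exact Or.inr (Or.inr (S.pt_inj (by omega) (by omega) h))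
  rcases h3 with h3 | h3 | h3
  · omega
  · right; obtain rfl : q = n := by omega
    obtain rfl : j = q - 1 := by omega
    exact ⟨rfl, hTa⟩
  · left; obtain rfl : j = m := by omega
    obtain rfl : q = j - 1 := by omega
    exact ⟨rfl, hTa⟩

/-- `lineCoeff` relation between `Z X ⋯ X Y` and its translate `Y X ⋯ X Z`. -/
theorem line_add_translate (S : LayeredSolution lay e J hx w k c) (hk : 2 ≤ k) (y : V) (p : ℤ) :
    lineCoeff c y e ∅ (p + 1) (p + k) p (p + k - 1) +
      lineCoeff c y e ∅ (p + 1) (p + k) (p + 1) (p + k) = 0 := by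
  have hL := S.two_k_le
  set u := seg y e (p + 1) (p + k) with hu
  set v : Finset V := {y + p • e} ∆ {y + (p + k) • e} ∆ ∅ with hv
  have hpv : y + p • e ∈ v := by
    simp [hv, Finset.mem_symmDiff, S.bond_ne y p (p + k) (by omega) (by omega) (by omega)]
  have hqv : y + (p + k) • e ∈ v := by
    simp [hv, Finset.mem_symmDiff, S.bond_ne y (p + k) p (by omega) (by omega) (by omega)]
  have hlay : lay (y + (p + k) • e) = lay (y + p • e) + k := by
    rw [S.lay_pt, S.lay_pt]; push_cast; ring
  have h1 : y + (p + 1) • e ∈ u := mem_seg.2 ⟨p + 1, by omega, by omega, rfl⟩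
  have h2 : y + p • e ∉ u := by rw [hu, S.pt_mem_seg (by omega) (by omega)]; omega
  have h3 : y + (p + k - 1) • e ∈ u := mem_seg.2 ⟨p + k - 1, by omega, by omega, rfl⟩
  have h4 : y + (p + k) • e ∉ u := by rw [hu, S.pt_mem_seg (by omega) (by omega)]; omega
  have hne : ({y + (p + 1) • e, y + p • e} : Finset V) ≠ {y + (p + k - 1) • e, y + (p + k) • e} :=
    fun h => by
      have : y + p • e ∈ ({y + (p + 1) • e, y + p • e} : Finset V) := by simp
      rw [h] at this
      simp only [Finset.mem_insert, Finset.mem_singleton] at this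
      rcases this with this | this
      · exact S.bond_ne y p (p + k - 1) (by omega) (by omega) (by omega) this
      · exact S.bond_ne y p (p + k) (by omega) (by omega) (by omega) this
  have h5 : y + (p + 1) • e ∉ v := by
    simp [hv, Finset.mem_symmDiff, S.bond_ne y (p + 1) p (by omega) (by omega) (by omega),
      S.bond_ne y (p + 1) (p + k) (by omega) (by omega) (by omega)]
  have h6 : y + (p + k - 1) • e ∉ v := by
    simp [hv, Finset.mem_symmDiff, S.bond_ne y (p + k - 1) p (by omega) (by omega) (by omega),
      S.bond_ne y (p + k - 1) (p + k) (by omega) (by omega) (by omega)]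
  -- The string `Z X ⋯ X Z` here has width `k + 1`; only the two bonds removing one of its end sites
  -- lead back to admissible width.
  have key := S.eqn_of_vanish (u := u) (v := v) ∅
    {{y + (p + 1) • e, y + p • e}, {y + (p + k - 1) • e, y + (p + k) • e}} (by simp)
    (fun t ht _ => by
      by_contra hc
      exact S.far hc (Finset.mem_union_right _ hpv) (Finset.mem_union_right _ hqv) hlay)
    (fun T hT hTu hTZ => by
      by_contra hc
      simp only [Finset.mem_insert, Finset.mem_singleton, not_or] at hTZ
      rcases S.end_cases hT hTu hpv (by omega) (by omega) (by omega) with h | ⟨-, h⟩ | ⟨h, -⟩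
      · rcases S.end_cases hT hTu hqv (by omega) (by omega) (by omega) with h' | ⟨h', -⟩ | ⟨-, h'⟩
        · exact S.far hc h h' hlay
        · omega
        · exact hTZ.2 h'
      · exact hTZ.1 (by rw [h, add_sub_cancel_right])
      · omega)
  rw [Finset.sum_empty, Finset.sum_pair hne, zterm_pair h1 h2, zterm_pair h3 h4, if_neg h5,
    if_neg h6, S.w_pt_swap y _ _ rfl, S.w_pt y _ _ (by ring),
    pair_eq_symmDiff (S.bond_ne y (p + 1) p (by omega) (by omega) (by omega)),
    pair_eq_symmDiff (S.bond_ne y (p + k - 1) (p + k) (by omega) (by omega) (by omega)),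
    symmDiff_comm {y + (p + 1) • e}, symmDiff_comm {y + (p + k - 1) • e}, hv,
    symmDiff_cancel_fst, symmDiff_cancel_snd] at key
  have h0 : J * (lineCoeff c y e ∅ (p + 1) (p + k) p (p + k - 1) +
      lineCoeff c y e ∅ (p + 1) (p + k) (p + 1) (p + k)) = 0 := by
    unfold lineCoeff; linear_combination key
  exact (mul_eq_zero.1 h0).resolve_left S.J_ne

/-- `lineCoeff` relation between `Z X ⋯ X Y` and `Y X ⋯ X Z` on the same sites. -/
theorem line_add_mirror (S : LayeredSolution lay e J hx w k c) (hk : 2 ≤ k) (y : V) (p : ℤ) :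
    lineCoeff c y e ∅ (p + 1) (p + k) p (p + k - 1) +
      lineCoeff c y e ∅ p (p + k - 1) p (p + k - 1) = 0 := by
  have hL := S.two_k_le
  set u := seg y e p (p + k) with hu
  set v : Finset V := {y + p • e} ∆ {y + (p + k - 1) • e} ∆ ∅ with hv
  have hne := S.bond_ne y p (p + k - 1) (by omega) (by omega) (by omega)
  have hv' : v = {y + p • e, y + (p + k - 1) • e} := by
    rw [hv, ← Finset.bot_eq_empty, symmDiff_bot, pair_eq_symmDiff hne]
  have h1 : y + p • e ∈ u := mem_seg.2 ⟨p, by omega, by omega, rfl⟩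
  have h2 : y + (p + k - 1) • e ∈ u := mem_seg.2 ⟨p + k - 1, by omega, by omega, rfl⟩
  -- The string is `Y X ⋯ X Y` of width `k`. Z-terms do not change `u`, which contains both ends, so
  -- only the flips of the two `Y` contribute.
  have key := S.eqn_of_vanish (u := u) (v := v) v ∅ subset_rfl (fun t ht h => absurd ht h)
    (fun T hT hTu hTZ => S.eq_zero_of_ends hk h1 h2 (by
      rw [S.lay_pt, S.lay_pt]; push_cast; ring))
  conv at key => enter [1, 1, 2, 1]; rw [hv']
  rw [Finset.sum_empty, Finset.sum_pair hne, if_pos h1, if_pos h2, hu,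
    S.seg_symmDiff_left y (by omega) (by omega), S.seg_symmDiff_pred y (by omega) (by omega)] at key
  have h0 : hx * (lineCoeff c y e ∅ (p + 1) (p + k) p (p + k - 1) +
      lineCoeff c y e ∅ p (p + k - 1) p (p + k - 1)) = 0 := by
    unfold lineCoeff; rw [← hv]; linear_combination key
  exact (mul_eq_zero.1 h0).resolve_left S.hx_ne

theorem pt_ne_offset (S : LayeredSolution lay e J hx w k c) {y g : V} (hg : lay g = 0)
    (hg0 : g ≠ 0) {i : ℤ} (h1 : i < L) (h2 : -i < L) : y + i • e ≠ y + g := by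
  intro h
  have h3 := congrArg lay h
  rw [S.lay_pt, map_add, hg] at h3
  have : i = 0 := intCast_inj (L := L) (by omega) (by omega) (by simpa using h3)
  subst this
  exact hg0 (by simpa using h.symm)

theorem offset_notMem_seg (S : LayeredSolution lay e J hx w k c) {y g : V} (hg : lay g = 0)
    (hg0 : g ≠ 0) {m n : ℤ} (h1 : n ≤ L) (h2 : -m < L) : y + g ∉ seg y e m n := by
  intro h
  obtain ⟨j, hm, hn, h⟩ := mem_seg.1 h
  exact S.pt_ne_offset hg hg0 (by omega) (by omega) h.symm

theorem pt_mem_pair (S : LayeredSolution lay e J hx w k c) (y : V) {i p q : ℤ}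
    (h1 : i - p < L) (h2 : p - i < L) (h3 : i - q < L) (h4 : q - i < L) :
    y + i • e ∈ ({y + p • e} ∆ {y + q • e} : Finset V) ↔ ¬ (i = p ↔ i = q) := by
  have hp : y + i • e = y + p • e ↔ i = p := ⟨S.pt_inj h1 h2, fun h => by rw [h]⟩
  have hq : y + i • e = y + q • e ↔ i = q := ⟨S.pt_inj h3 h4, fun h => by rw [h]⟩
  simp only [Finset.mem_symmDiff, Finset.mem_singleton, hp, hq]
  tauto

theorem pt_mem_bent (S : LayeredSolution lay e J hx w k c) {y g : V} (hg : lay g = 0)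
    (hg0 : g ≠ 0) {i p q : ℤ} (h1 : i - p < L) (h2 : p - i < L) (h3 : i - q < L) (h4 : q - i < L)
    (h5 : i < L) (h6 : -i < L) :
    y + i • e ∈ ({y + p • e} ∆ {y + q • e} ∆ {y, y + g} : Finset V) ↔
      ¬ (¬ (i = p ↔ i = q) ↔ i = 0) := by
  have h0 : y + i • e = y ↔ i = 0 := by
    constructor
    · intro h
      exact S.pt_inj (y := y) (by omega) (by omega) (by simpa using h)
    · rintro rfl; simp
  rw [Finset.mem_symmDiff, S.pt_mem_pair y h1 h2 h3 h4]
  simp only [Finset.mem_insert, Finset.mem_singleton, h0, S.pt_ne_offset hg hg0 h5 h6, or_false]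
  tauto

theorem base_mem_bent (S : LayeredSolution lay e J hx w k c) {y g : V} (hg : lay g = 0)
    (hg0 : g ≠ 0) {p q : ℤ} (h1 : -p < L) (h2 : p < L) (h3 : -q < L) (h4 : q < L) :
    y ∈ ({y + p • e} ∆ {y + q • e} ∆ {y, y + g} : Finset V) ↔ (0 = p ↔ 0 = q) := by
  have := S.pt_mem_bent (y := y) hg hg0 (i := 0) (p := p) (q := q) (by omega) (by omega)
    (by omega) (by omega) (by omega) (by omega)
  rw [zero_smul, add_zero] at this
  rw [this]
  simp

theorem base_mem_seg {V : Type*} [AddCommGroup V] [DecidableEq V] {e y : V} {m n : ℤ} (hm : m ≤ 0) (hn : 0 < n) : y ∈ seg y e m n :=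
  mem_seg.2 ⟨0, hm, hn, by simp⟩

theorem offset_ne_bond (S : LayeredSolution lay e J hx w k c) {y g : V} (hg : lay g = 0)
    (hg0 : g ≠ 0) {i j : ℤ} (h1 : i < L) (h2 : -i < L) (h3 : j < L) (h4 : -j < L) :
    ({y, y + g} : Finset V) ≠ {y + i • e, y + j • e} := fun h => by
  have : y + g ∈ ({y, y + g} : Finset V) := by simp
  rw [h] at this
  simp only [Finset.mem_insert, Finset.mem_singleton] at this
  rcases this with this | this
  · exact S.pt_ne_offset hg hg0 h1 h2 this.symm
  · exact S.pt_ne_offset hg hg0 h3 h4 this.symm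

theorem symmDiff_singleton_ne {V : Type*} [DecidableEq V] (u : Finset V) (t : V) :
    u ∆ {t} ≠ u := by
  rw [Ne, symmDiff_eq_left]; simp

/-- The equation of the string `Z X ⋯ X Y` multiplied by an in-layer bond in its interior. -/
theorem bent_right (S : LayeredSolution lay e J hx w k c) {y g : V} (hg : lay g = 0)
    (hg0 : g ≠ 0) {p : ℤ} (h1 : 2 - k ≤ p) (h2 : p ≤ -1) :
    -w {y, y + g} * lineCoeff c y e ∅ (p + 1) (p + k) p (p + k - 1) +
      hx * lineCoeff c y e {y, y + g} (p + 1) (p + k - 1) p (p + k - 1) +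
      J * (if p = -1 then -1 else 1) *
        lineCoeff c y e {y, y + g} (p + 1) (p + k) (p + 1) (p + k - 1) = 0 := by
  have hk : 2 ≤ k := by omega
  have hL := S.two_k_le
  set u := seg y e (p + 1) (p + k) with hu
  set v : Finset V := {y + p • e} ∆ {y + (p + k - 1) • e} ∆ {y, y + g} with hv
  have mem : ∀ i, p ≤ i → i ≤ p + k → (y + i • e ∈ v ↔
      ¬ (¬ (i = p ↔ i = p + k - 1) ↔ i = 0)) := fun i _ _ =>
    S.pt_mem_bent hg hg0 (by omega) (by omega) (by omega) (by omega) (by omega) (by omega)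
  have hpv : y + p • e ∈ v := (mem p (by omega) (by omega)).2 (by omega)
  have hqv : y + (p + k - 1) • e ∈ v := (mem _ (by omega) (by omega)).2 (by omega)
  have hqu : y + (p + k - 1) • e ∈ u := mem_seg.2 ⟨p + k - 1, by omega, by omega, rfl⟩
  have hlay : lay (y + (p + k - 1) • e) + 1 = lay y + (p + k : ℤ) := by
    rw [S.lay_pt]; push_cast; ring
  have hyv : y ∈ v := (S.base_mem_bent hg hg0 (by omega) (by omega) (by omega) (by omega)).2
    (by omega)
  have hyu : y ∈ u := base_mem_seg (by omega) (by omega)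
  have hgu : y + g ∉ u := S.offset_notMem_seg hg hg0 (by omega) (by omega)
  have h3 : y + (p + 1) • e ∈ u := mem_seg.2 ⟨p + 1, by omega, by omega, rfl⟩
  have h4 : y + p • e ∉ u := by rw [hu, S.pt_mem_seg (by omega) (by omega)]; omega
  -- Three contributions survive: removing the in-layer bond, turning the final `Y` into `Z`, and
  -- removing the leading `Z`. Any other term leaves a maximal string with `X` or `Y` at its end
  -- that is not a straight line.
  have key := S.eqn_of_vanish (u := u) (v := v) {y + (p + k - 1) • e}
    {{y, y + g}, {y + (p + 1) • e, y + p • e}} (by simpa using hqv)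
    (fun t ht htX => by
      by_contra hc
      refine symmDiff_singleton_ne u t (S.eq_line_of_pt_right hk hc
        (Finset.mem_union_right _ hpv) (r := y + (p + k - 1) • e) ?_ hlay).1
      simp only [Finset.mem_singleton] at htX
      exact Finset.mem_symmDiff.2 (Or.inl ⟨hqu, by simpa using Ne.symm htX⟩))
    (fun T hT hTu hTZ => by
      by_contra hc
      simp only [Finset.mem_insert, Finset.mem_singleton, not_or] at hTZ
      rcases S.end_cases hT hTu hpv (by omega) (by omega) (by omega) with h | ⟨-, h⟩ | ⟨h, -⟩
      · have := (S.eq_line_of_pt_right hk hc h hqu hlay).2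
        rw [pair_eq_symmDiff (S.bond_ne y p (p + k - 1) (by omega) (by omega) (by omega)), hv,
          symmDiff_assoc, symmDiff_eq_left, symmDiff_eq_bot] at this
        exact hTZ.1 this.symm
      · exact hTZ.2 (by rw [h, add_sub_cancel_right])
      · omega)
  rw [Finset.sum_singleton, Finset.sum_pair (S.offset_ne_bond hg hg0 (by omega) (by omega)
    (by omega) (by omega)), zterm_pair hyu hgu, zterm_pair h3 h4, if_pos hqu, if_pos hyv,
    S.w_pt_swap y _ _ rfl, pair_eq_symmDiff (S.bond_ne y (p + 1) p (by omega) (by omega) (by omega)),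
    symmDiff_comm {y + (p + 1) • e}, hv, symmDiff_symmDiff_cancel_right,
    symmDiff_cancel_fst, ← hv, hu, S.seg_symmDiff_pred y (by omega) (by omega)] at key
  -- For `p = -1` the site after the leading `Z` is `y`, which the in-layer bond has turned from `X`
  -- into `Y`.
  have hsign : (if y + (p + 1) • e ∈ v then (-1 : ℂ) else 1) = if p = -1 then -1 else 1 := by
    refine if_congr ?_ rfl rfl
    rw [mem _ (by omega) (by omega)]; omega
  rw [hsign] at key
  simp only [lineCoeff, ← Finset.bot_eq_empty, symmDiff_bot]
  linear_combination key

/-- The equation of the string `Y X ⋯ X Z` multiplied by an in-layer bond in its first layer. -/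
theorem bent_first (S : LayeredSolution lay e J hx w k c) (hk : 2 ≤ k) {y g : V} (hg : lay g = 0)
    (hg0 : g ≠ 0) :
    w {y, y + g} * lineCoeff c y e ∅ 0 (k - 1) 0 (k - 1) +
      J * lineCoeff c y e {y, y + g} 0 (k - 1) 0 (k - 2) = 0 := by
  have hL := S.two_k_le
  set u := seg y e 0 (k - 1) with hu
  set v : Finset V := {y + (0 : ℤ) • e} ∆ {y + ((k : ℤ) - 1) • e} ∆ {y, y + g} with hv
  have mem : ∀ i : ℤ, 0 ≤ i → i ≤ k → (y + i • e ∈ v ↔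
      ¬ (¬ (i = 0 ↔ i = k - 1) ↔ i = 0)) := fun i _ _ =>
    S.pt_mem_bent hg hg0 (by omega) (by omega) (by omega) (by omega) (by omega) (by omega)
  have hqv : y + ((k : ℤ) - 1) • e ∈ v := (mem _ (by omega) (by omega)).2 (by omega)
  have hqu : y + ((k : ℤ) - 1) • e ∉ u := by
    rw [hu, S.pt_mem_seg (by omega) (by omega)]; omega
  have hyv : y ∉ v := by
    rw [hv, S.base_mem_bent hg hg0 (by omega) (by omega) (by omega) (by omega)]; omega
  have hyu : y ∈ u := base_mem_seg (by omega) (by omega)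
  have hgu : y + g ∉ u := S.offset_notMem_seg hg hg0 (by omega) (by omega)
  have h3 : y + ((k : ℤ) - 2) • e ∈ u := mem_seg.2 ⟨k - 2, by omega, by omega, rfl⟩
  have h4 : y + ((k : ℤ) - 2) • e ∉ v := by
    rw [mem _ (by omega) (by omega)]; omega
  have e0 : ∀ n : ℤ, (0 : ℤ) + n = n := zero_add
  -- The in-layer bond turns the first `Y` into `X`, so no X-term can act on `y`; every term keeping
  -- the last site then leaves a maximal string with `X` or `Y` first.
  have key := S.eqn_of_vanish (u := u) (v := v) ∅
    {{y, y + g}, {y + ((k : ℤ) - 2) • e, y + ((k : ℤ) - 1) • e}} (by simp)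
    (fun t ht _ => by
      by_contra hc
      have := (S.eq_line_of_pt_left hk hc (y := y) (s := y) (p := 0) ?_
        (Finset.mem_union_right _ (by rwa [e0])) (by simp)).1
      · rw [e0] at this; exact symmDiff_singleton_ne u t this
      · refine Finset.mem_symmDiff.2 (Or.inl ⟨hyu, ?_⟩)
        rw [Finset.mem_singleton]; rintro rfl; exact hyv ht)
    (fun T hT hTu hTZ => by
      by_contra hc
      simp only [Finset.mem_insert, Finset.mem_singleton, not_or] at hTZ
      rcases S.end_cases hT hTu hqv (by omega) (by omega) (by omega) with h | ⟨h, -⟩ | ⟨-, h⟩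
      · have := (S.eq_line_of_pt_left hk hc (y := y) (p := 0) hyu (by rwa [e0]) (by simp)).2
        rw [e0, pair_eq_symmDiff (S.bond_ne y 0 (k - 1) (by omega) (by omega) (by omega)), hv,
          symmDiff_assoc, symmDiff_eq_left, symmDiff_eq_bot] at this
        exact hTZ.1 this.symm
      · omega
      · exact hTZ.2 (by rw [h, show (k : ℤ) - 1 - 1 = k - 2 by ring]))
  rw [Finset.sum_empty, Finset.sum_pair (S.offset_ne_bond hg hg0 (by omega) (by omega)
    (by omega) (by omega)), zterm_pair hyu hgu, zterm_pair h3 hqu, if_neg hyv, if_neg h4,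
    S.w_pt y _ _ (by ring),
    pair_eq_symmDiff (S.bond_ne y (k - 2) (k - 1) (by omega) (by omega) (by omega)),
    symmDiff_comm {y + ((k : ℤ) - 2) • e}, hv, symmDiff_symmDiff_cancel_right,
    symmDiff_cancel_snd] at key
  simp only [lineCoeff, ← Finset.bot_eq_empty, symmDiff_bot]
  linear_combination key

/-- Mirror image of `bent_right`: the substitution `p ↦ -(p + k - 1)` exchanges the exceptional
positions `-1` and `2 - k`. -/
theorem bent_left (S : LayeredSolution lay e J hx w k c) {y g : V} (hg : lay g = 0)
    (hg0 : g ≠ 0) {p : ℤ} (h1 : 2 - k ≤ p) (h2 : p ≤ -1) :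
    -w {y, y + g} * lineCoeff c y e ∅ p (p + k - 1) p (p + k - 1) +
      hx * lineCoeff c y e {y, y + g} (p + 1) (p + k - 1) p (p + k - 1) +
      J * (if p = 2 - k then -1 else 1) *
        lineCoeff c y e {y, y + g} p (p + k - 1) p (p + k - 2) = 0 := by
  have := S.reflect.bent_right (y := y) (g := g) (by simp [hg]) hg0 (p := -(p + k - 1))
    (by omega) (by omega)
  simp only [lineCoeff_neg] at this
  have hs : (if -(p + k - 1) = -1 then (-1 : ℂ) else 1) = if p = 2 - k then -1 else 1 :=
    if_congr (by omega) rfl rfl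
  rw [hs] at this
  convert this using 4 <;> first | omega | (congr 1 <;> omega)

theorem bent_last (S : LayeredSolution lay e J hx w k c) (hk : 2 ≤ k) {y g : V} (hg : lay g = 0)
    (hg0 : g ≠ 0) :
    w {y, y + g} * lineCoeff c y e ∅ (2 - k) 1 (1 - k) 0 +
      J * lineCoeff c y e {y, y + g} (2 - k) 1 (2 - k) 0 = 0 := by
  have := S.reflect.bent_first hk (y := y) (g := g) (by simp [hg]) hg0
  simp only [lineCoeff_neg] at this
  convert this using 3 <;> first | omega | (congr 1 <;> omega)

/-- Passing from `Y X ⋯ X Z` to `Z X ⋯ X Y` on the same sites, and from there to `Y X ⋯ X Z` one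
step further, changes the sign twice. -/
theorem left_line_const (S : LayeredSolution lay e J hx w k c) (hk : 2 ≤ k) (y : V) (p : ℤ) :
    lineCoeff c y e ∅ p (p + k - 1) p (p + k - 1) = lineCoeff c y e ∅ 0 (k - 1) 0 (k - 1) := by
  have step : ∀ p : ℤ, lineCoeff c y e ∅ (p + 1) (p + 1 + k - 1) (p + 1) (p + 1 + k - 1) =
      lineCoeff c y e ∅ p (p + k - 1) p (p + k - 1) := fun p => by
    have h1 := S.line_add_translate hk y p
    have h2 := S.line_add_mirror hk y p
    rw [show p + 1 + (k : ℤ) - 1 = p + k by ring]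
    linear_combination h1 - h2
  induction p using Int.induction_on with
  | zero => simp
  | succ i ih => rw [step, ih]
  | pred i ih => rw [← ih, ← step (-(i : ℤ) - 1), sub_add_cancel]

/-- Maximal lines `Y X ⋯ X Z` have coefficient zero. -/
theorem left_line_eq_zero (S : LayeredSolution lay e J hx w k c) (hk : 2 ≤ k) {y g : V}
    (hg : lay g = 0) (hg0 : g ≠ 0) (hw : w {y, y + g} ≠ 0) :
    lineCoeff c y e ∅ 0 (k - 1) 0 (k - 1) = 0 := by
  set β := lineCoeff c y e ∅ 0 (k - 1) 0 (k - 1) with hβ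
  set W := w {y, y + g} with hW
  have hb := S.left_line_const hk y
  rw [← hβ] at hb
  have ha : ∀ p : ℤ, lineCoeff c y e ∅ (p + 1) (p + k) p (p + k - 1) = -β := fun p => by
    have := S.line_add_mirror hk y p
    rw [hb] at this
    linear_combination this
  -- The unknowns to be eliminated: `E` belongs to bent lines `Y X ⋯ X Y` of width `k - 1`, `D` to
  -- bent lines `Z X ⋯ X Z` of width `k`.
  set E : ℤ → ℂ := fun q => lineCoeff c y e {y, y + g} q (q + k - 1) q (q + k - 2) with hE
  set D : ℤ → ℂ := fun p => lineCoeff c y e {y, y + g} (p + 1) (p + k - 1) p (p + k - 1) with hD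
  have hR : ∀ p : ℤ, 2 - (k : ℤ) ≤ p → p ≤ -1 →
      W * β + hx * D p + J * (if p = -1 then -1 else 1) * E (p + 1) = 0 := fun p h1 h2 => by
    have := S.bent_right (y := y) hg hg0 h1 h2
    rw [ha] at this
    simp only [hE, hD, hW]
    rw [show p + 1 + (k : ℤ) - 1 = p + k by ring, show p + 1 + (k : ℤ) - 2 = p + k - 1 by ring]
    linear_combination this
  have hLe : ∀ p : ℤ, 2 - (k : ℤ) ≤ p → p ≤ -1 →
      -(W * β) + hx * D p + J * (if p = 2 - k then -1 else 1) * E p = 0 := fun p h1 h2 => by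
    have := S.bent_left (y := y) hg hg0 h1 h2
    rw [hb] at this
    linear_combination this
  have hF : W * β + J * E 0 = 0 := by
    have := S.bent_first hk (y := y) hg hg0
    simpa [hE] using this
  have hG : -(W * β) + J * E (2 - k) = 0 := by
    have := S.bent_last hk (y := y) hg hg0
    have h2 := ha (1 - k)
    rw [show 1 - (k : ℤ) + 1 = 2 - k by ring, show 1 - (k : ℤ) + k = 1 by ring, sub_self] at h2
    rw [h2] at this
    simp only [hE]
    rw [show 2 - (k : ℤ) + k - 1 = 1 by ring, show 2 - (k : ℤ) + k - 2 = 0 by ring]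
    linear_combination this
  have hWβ : W * β = 0 := by
    -- For `k = 2` no interior position exists, and `hF` and `hG` contain the same unknown `E 0`
    -- with opposite signs of `W * β`.
    rcases hk.eq_or_lt with rfl | hk3
    · simp only [Nat.cast_ofNat, sub_self] at hG
      linear_combination (hF - hG) / 2
    -- Starting from the boundary equation `hF`, each step of the line across `y` eliminates one `E`
    -- and contributes `-2 * (W * β)`.
    have hDn : ∀ n : ℕ, 1 ≤ n → n + 2 ≤ k → hx * D (-n) = -2 * n * (W * β) := by
      intro n hn
      induction n, hn using Nat.le_induction with
      | base =>
        intro _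
        have := hR (-1) (by omega) (by omega)
        simp only [if_true, neg_add_cancel] at this
        push_cast
        linear_combination this + hF
      | succ n hn ih =>
        intro hnk
        have h1 := hLe (-n) (by omega) (by omega)
        have h2 := hR (-(n + 1 : ℕ)) (by omega) (by omega)
        rw [if_neg (by omega)] at h1
        rw [if_neg (by omega), show -((n + 1 : ℕ) : ℤ) + 1 = -n by push_cast; ring] at h2
        have h3 := ih (by omega)
        push_cast at h2 ⊢
        linear_combination h2 - h1 + h3
    have h1 := hDn (k - 2) (by omega) (by omega)
    have h2 := hLe (2 - k) (by omega) (by omega)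
    rw [if_pos rfl] at h2
    rw [show (-((k - 2 : ℕ) : ℤ)) = 2 - k by push_cast [Nat.cast_sub hk]; ring,
      Nat.cast_sub hk] at h1
    -- The far boundary demands `hx * D (2 - k) = 2 * (W * β)`, while the chain gives `-2 * (k - 2)
    -- * (W * β)`.
    have h3 : ((2 * k - 2 : ℕ) : ℂ) * (W * β) = 0 := by
      rw [Nat.cast_sub (by omega)]
      push_cast at h1 ⊢
      linear_combination -h2 - hG + h1
    refine (mul_eq_zero.1 h3).resolve_left ?_
    exact Nat.cast_ne_zero.2 (by omega)
  exact (mul_eq_zero.1 hWβ).resolve_left hw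

end LayeredSolution

/-! ### Maximal strings with `Z` at both ends. -/

/-- Maximal-width strings with nonzero coefficient have only `Z` in the first and last layer. -/
def EndFree {V : Type*} [AddCommGroup V] [DecidableEq V] {L : ℕ} (lay : V →+ ZMod L) (k : ℕ)
    (c : Finset V → Finset V → ℂ) : Prop :=
  ∀ u v, c u v ≠ 0 → ∀ s r, s ∈ u ∪ v → r ∈ u ∪ v → lay r + 1 = lay s + k → s ∉ u ∧ r ∉ u

theorem EndFree.reflect {V : Type*} [AddCommGroup V] [DecidableEq V] {L : ℕ} {lay : V →+ ZMod L}
    {k : ℕ} {c : Finset V → Finset V → ℂ} (h : EndFree lay k c) : EndFree (-lay) k c :=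
  fun u v hc s r hs hr hl => (h u v hc r s hr hs (by
    simp only [AddMonoidHom.neg_apply] at hl; linear_combination hl)).symm

namespace LayeredSolution

variable {V : Type*} [AddCommGroup V] [Fintype V] [DecidableEq V] {L : ℕ}
  {lay : V →+ ZMod L} {e : V} {J hx : ℂ} {w : Finset V → ℂ} {k : ℕ}
  {c : Finset V → Finset V → ℂ}

/-- A violating string is a line `Y X ⋯ X Z`. Anchored at its last site `r`, its coefficient is the
common value along the line, which is zero by `left_line_eq_zero`. -/
theorem first_notMem (S : LayeredSolution lay e J hx w k c) (hk : 2 ≤ k) {g : V}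
    (hg : lay g = 0) (hg0 : g ≠ 0) (hw : ∀ y, w {y, y + g} ≠ 0) {u v : Finset V}
    (hc : c u v ≠ 0) {s r : V} (hr : r ∈ u ∪ v) (hl : lay r + 1 = lay s + k) :
    s ∉ u := by
  intro hs
  have hk1 : (1 - (k : ℤ)) + k - 1 = 0 := by ring
  obtain ⟨rfl, rfl⟩ := S.eq_line_of_pt_left hk hc (y := r) (p := 1 - k) hs
    (by rwa [hk1, zero_smul, add_zero]) (by push_cast; linear_combination -hl)
  have hL := S.two_k_le
  have h1 := S.left_line_const hk r (1 - k)
  rw [S.left_line_eq_zero hk hg hg0 (hw r), lineCoeff, ← Finset.bot_eq_empty, symmDiff_bot,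
    ← pair_eq_symmDiff (S.bond_ne r _ _ (by omega) (by omega) (by omega))] at h1
  exact hc h1

theorem endFree (S : LayeredSolution lay e J hx w k c) (hk : 2 ≤ k) {g : V}
    (hg : lay g = 0) (hg0 : g ≠ 0) (hw : ∀ y, w {y, y + g} ≠ 0) : EndFree lay k c :=
  fun _ _ hc _ _ hs hr hl => ⟨S.first_notMem hk hg hg0 hw hc hr hl,
    S.reflect.first_notMem hk (by simp [hg]) hg0 hw hc hs (by
      simp only [AddMonoidHom.neg_apply]; linear_combination hl)⟩

/-- Let `X` act on the last site. A compensating string that still has width `k` would violate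
`EndFree`, so a bond must delete the whole first layer, which is therefore a single site. -/
theorem first_of_endFree (S : LayeredSolution lay e J hx w k c) (hk : 2 ≤ k)
    (hE : EndFree lay k c) {u v : Finset V} (hc : c u v ≠ 0) {s r : V} (hs : s ∈ u ∪ v)
    (hr : r ∈ u ∪ v) (hl : lay r + 1 = lay s + k) :
    (∀ t ∈ u ∪ v, lay t = lay s → t = s) ∧ s + e ∈ u ∆ {r} ∧
      c (u ∆ {r}) (v ∆ {s, s + e}) ≠ 0 := by
  have hL := S.two_k_le
  obtain ⟨hsu, hru⟩ := hE u v hc s r hs hr hl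
  have hvof : ∀ t ∈ u ∪ v, t ∉ u → t ∈ v := fun t ht h => (Finset.mem_union.1 ht).resolve_left h
  have hsv := hvof s hs hsu
  have hrv := hvof r hr hru
  have hru' : r ∈ u ∆ {r} := by simp [Finset.mem_symmDiff, hru]
  rcases S.exists_other_of_site hc hrv with ⟨t, ht, htr, hct⟩ | ⟨T, hT, hTu, hcT⟩
  · have h1 : r ∈ u ∆ {r} ∆ {t} :=
      Finset.mem_symmDiff.2 (Or.inl ⟨hru', by simpa using Ne.symm htr⟩)
    exact absurd h1 (hE _ _ hct s r (Finset.mem_union_right _ hsv) (Finset.mem_union_left _ h1)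
      hl).2
  have hsub : ∀ a ∈ u ∆ {r}, a ∈ u ∪ v := fun a ha => by
    rcases Finset.mem_symmDiff.1 ha with h | h
    · exact Finset.mem_union_left _ h.1
    · rw [Finset.mem_singleton.1 h.1]; exact hr
  have hgone : ∀ t, lay t = lay s → t ∉ u ∆ {r} ∪ v ∆ T := fun t htl ht =>
    (hE _ _ hcT t r ht (Finset.mem_union_left _ hru') (by rw [hl, htl])).2 hru'
  rcases S.mem_or_removed hT hTu (Finset.mem_union_right _ hsv) with h | ⟨a, ha, -, -, hTa, h⟩
  · exact absurd h (hgone s rfl)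
  have hae : a = s + e := by
    rcases h with h | h | h
    · exact absurd (Finset.mem_union_left _ ha) (hgone a h.symm)
    · have := S.box_lt hc hs hr hl (hsub a ha) (n := L - 1) (by omega)
        (by rw [h, map_add, S.lay_e, Nat.cast_sub (by omega)]; simp)
      omega
    · exact h
  subst hae
  rw [Finset.pair_comm] at hTa
  refine ⟨fun t ht htl => ?_, ha, hTa ▸ hcT⟩
  by_contra hts
  refine hgone t htl (Finset.mem_union_right _ (Finset.mem_symmDiff.2 (Or.inl ⟨?_, ?_⟩)))
  · exact hvof t ht (hE u v hc t r ht hr (by rw [hl, htl])).1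
  · have : t ≠ s + e := by
      rintro rfl
      exact lay_ne (x := lay s) (n := 1) (by omega) (by omega)
        (by rw [Nat.cast_one, ← S.lay_e, ← map_add, htl])
    simp [hTa, hts, this]

/-- The bond `{r, r + e}` widens the string to width `k`. Compensating strings of that width may not
have `X` or `Y` at `s`, which leaves only the X-term at `s`. Together with `first_of_endFree` this
moves a maximal string forward by one layer. -/
theorem extend_of_endFree (S : LayeredSolution lay e J hx w k c)
    (hE : EndFree lay k c) {u v : Finset V} (hc : c u v ≠ 0) {s r : V} (hs : s ∈ u)
    (hr : r ∈ u) (hl : lay r + 1 + 1 = lay s + k) :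
    s ∈ v ∆ {r, r + e} ∧ r + e ∈ v ∆ {r, r + e} ∧ c (u ∆ {s}) (v ∆ {r, r + e}) ≠ 0 := by
  have hlr : lay (r + e) + 1 = lay s + k := by rw [map_add, S.lay_e, hl]
  have hs' : ∀ {v : Finset V}, s ∈ u ∪ v := Finset.mem_union_left _ hs
  have hre : r + e ∉ u ∪ v := fun h => (hE u v hc s (r + e) hs' h hlr).1 hs
  have hreu : r + e ∉ u := fun h => hre (Finset.mem_union_left _ h)
  have hrev : r + e ∉ v := fun h => hre (Finset.mem_union_right _ h)
  have hreB : r + e ∈ v ∆ {r, r + e} := by simp [Finset.mem_symmDiff, hrev]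
  rcases S.exists_other_of_pair hc hr hreu (by rw [S.w_bond]; exact S.J_ne) with
    ⟨t, ht, hct⟩ | ⟨T, hT, hTu, hTne, hcT⟩
  · by_cases hts : t = s
    · subst hts; exact ⟨ht, hreB, hct⟩
    have h1 : s ∈ u ∆ {t} := Finset.mem_symmDiff.2 (Or.inl ⟨hs, by simpa using Ne.symm hts⟩)
    exact absurd h1 (hE _ _ hct s (r + e) (Finset.mem_union_left _ h1)
      (Finset.mem_union_right _ hreB) hlr).1
  · exfalso
    rcases S.mem_or_removed hT hTu (Finset.mem_union_right u hreB) with h | ⟨a, ha, -, -, hTa, h⟩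
    · exact (hE _ _ hcT s (r + e) hs' h hlr).1 hs
    rcases h with h | h | h
    · exact (hE _ _ hc s a hs' (Finset.mem_union_left _ ha) (by rw [← h, hlr])).1 hs
    · rw [← add_right_cancel h] at hTa; exact hTne hTa
    · exact S.far hc hs' (Finset.mem_union_left _ ha) (by rw [h, map_add, S.lay_e, hlr])

/-- If the ends of all maximal-width strings are `Z`, these strings are lines `Z X ⋯ X Z`. -/
theorem eq_line_of_endFree (S : LayeredSolution lay e J hx w k c) (hk : 2 ≤ k)
    (hE : EndFree lay k c) {u v : Finset V} (hc : c u v ≠ 0) {s r : V} (hs : s ∈ u ∪ v)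
    (hr : r ∈ u ∪ v) (hl : lay r + 1 = lay s + k) :
    u = seg s e 1 (k - 1) ∧ v = {s, s + ((k : ℤ) - 1) • e} ∧ r = s + ((k : ℤ) - 1) • e := by
  have hL := S.two_k_le
  let Φ : Finset V → Finset V → V → V → Prop := fun u v s r =>
    c u v ≠ 0 ∧ s ∈ u ∪ v ∧ r ∈ u ∪ v ∧ lay r + 1 = lay s + k
  have hstep : ∀ u v s r, Φ u v s r → s + e ∈ u ∆ {r} ∧ s + e ∈ v ∆ {s, s + e} ∆ {r, r + e} ∧
      Φ (u ∆ {r} ∆ {s + e}) (v ∆ {s, s + e} ∆ {r, r + e}) (s + e) (r + e) := by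
    rintro u v s r ⟨hc, hs, hr, hl⟩
    obtain ⟨-, h2, h3⟩ := S.first_of_endFree hk hE hc hs hr hl
    have hru := (hE u v hc s r hs hr hl).2
    obtain ⟨h4, h5, h6⟩ := S.extend_of_endFree hE h3 h2 (r := r)
      (by simp [Finset.mem_symmDiff, hru]) (by rw [map_add, S.lay_e]; linear_combination hl)
    exact ⟨h2, h4, h6, Finset.mem_union_right _ h4, Finset.mem_union_right _ h5,
      by rw [map_add, map_add, S.lay_e]; linear_combination hl⟩
  obtain ⟨hreq, h1, h2⟩ := S.line_of_shift (u := u) (v := v) (s := s) (r := r) hk Φ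
    (fun u v s r h => h.2.2.2)
    (by
      rintro u v s r h t ht htl
      obtain ⟨-, -, hc', hs', hr', hl'⟩ := hstep u v s r h
      obtain ⟨hc, hs, hr, hl⟩ := h
      by_contra hts
      refine hts ((S.first_of_endFree hk hE hc' hs' hr' hl').1 t ?_
        (by rw [htl, map_add, S.lay_e]))
      obtain ⟨a1, a2, a3, a4, a5, a6⟩ := S.ends_ne hk hl
      have hru := (hE u v hc s r hs hr hl).2
      have htre : t ≠ r + e := by
        rintro rfl
        exact S.far hc hs ht (by rw [map_add, S.lay_e, hl])
      have hts0 : t ≠ s := by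
        rintro rfl
        exact lay_ne (x := lay t) (n := 1) (by omega) (by omega) (by simpa using htl)
      rw [Finset.mem_union] at ht ⊢
      by_cases htr : t = r
      · subst htr; left; simp [Finset.mem_symmDiff, hru, hts]
      · rcases ht with ht | ht
        · left; simp [Finset.mem_symmDiff, ht, htr, hts]
        · right; simp [Finset.mem_symmDiff, ht, htre, hts, htr, hts0])
    (by
      rintro u v s r h hk3
      obtain ⟨h1, h2, -⟩ := hstep u v s r h
      obtain ⟨hc, hs, hr, hl⟩ := h
      obtain ⟨a1, a2, a3, a4, a5, a6⟩ := S.ends_ne hk hl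
      refine ⟨by simpa [Finset.mem_symmDiff, (a3 hk3).symm] using h1, fun hv => ?_⟩
      simp [Finset.mem_symmDiff, hv, (a3 hk3).symm, a2.symm] at h2)
    (fun u v s r h => h.2.2.1)
    (by
      rintro u v s r h
      refine ⟨_, _, (hstep u v s r h).2.2, fun hk3 => ?_, fun t h1 h2 h3 h4 => ?_⟩
      · obtain ⟨hc, hs, hr, hl⟩ := h
        obtain ⟨a1, a2, a3, a4, a5, a6⟩ := S.ends_ne hk hl
        have hru := (hE u v hc s r hs hr hl).2
        simp [Finset.mem_symmDiff, hru, a3 hk3]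
      · simp [Finset.mem_symmDiff, h1, h2, h3, h4]) ⟨hc, hs, hr, hl⟩
  obtain ⟨hsu, hru⟩ := hE u v hc s r hs hr hl
  have huniq := (S.first_of_endFree hk hE hc hs hr hl).1
  have hr' : r = s + ((k : ℤ) - 1) • e := by
    rw [hreq, ← natCast_zsmul, Nat.cast_sub (by omega), Nat.cast_one]
  have hcov : ∀ t ∈ u ∪ v, t = s ∨ t = r ∨ ∃ j : ℕ, 1 ≤ j ∧ j + 2 ≤ k ∧ t = s + j • e := by
    intro t ht
    obtain ⟨j, hj, hjl⟩ := S.box hc hs hr hl ht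
    rcases Nat.eq_zero_or_pos j with rfl | hj0
    · left; exact huniq t ht (by simpa using hjl)
    · right
      have := h1 j hj0 (by omega) t ht hjl
      rcases eq_or_ne j (k - 1) with rfl | hjk
      · left; rw [this, hreq]
      · right; exact ⟨j, hj0, by omega, this⟩
  refine ⟨?_, ?_, hr'⟩
  · ext t
    rw [mem_seg]
    constructor
    · intro ht
      rcases hcov t (Finset.mem_union_left _ ht) with rfl | rfl | ⟨j, hj1, hj2, rfl⟩
      · exact absurd ht hsu
      · exact absurd ht hru
      · exact ⟨j, by omega, by omega, by simp⟩
    · rintro ⟨j, hj1, hj2, rfl⟩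
      lift j to ℕ using by omega
      rw [natCast_zsmul]
      exact (h2 j (by omega) (by omega)).1
  · rw [← hr']
    ext t
    simp only [Finset.mem_insert, Finset.mem_singleton]
    constructor
    · intro ht
      rcases hcov t (Finset.mem_union_right _ ht) with h | h | ⟨j, hj1, hj2, rfl⟩
      · exact Or.inl h
      · exact Or.inr h
      · exact absurd ht (h2 j hj1 hj2).2
    · rintro (rfl | rfl)
      · exact (Finset.mem_union.1 hs).resolve_left hsu
      · exact (Finset.mem_union.1 hr).resolve_left hru

theorem eq_line_of_pt_endFree (S : LayeredSolution lay e J hx w k c) (hk : 2 ≤ k)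
    (hE : EndFree lay k c) {u v : Finset V} (hc : c u v ≠ 0) {y r : V} {p : ℤ}
    (hs : y + p • e ∈ u ∪ v) (hr : r ∈ u ∪ v) (hl : lay r + 1 = lay y + (p + k : ℤ)) :
    u = seg y e (p + 1) (p + k - 1) ∧ v = {y + p • e} ∆ {y + (p + k - 1) • e} := by
  have hL := S.two_k_le
  have := S.eq_line_of_endFree hk hE hc hs hr (by rw [hl, S.lay_pt]; push_cast; ring)
  have h2 : y + p • e + ((k : ℤ) - 1) • e = y + (p + k - 1) • e := by
    rw [add_assoc, ← add_smul]; congr 2; ring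
  rw [seg_translate, h2, pair_eq_symmDiff (S.bond_ne y _ _ (by omega) (by omega) (by omega))]
    at this
  refine ⟨?_, this.2.1⟩
  rw [this.1]; congr 1; ring

/-- A string of width `k - 1` with `X` or `Y` in its first and last layer is a line
`Y X ⋯ X Y`. -/
theorem eq_short_line_of_endFree (S : LayeredSolution lay e J hx w k c) (hk : 2 ≤ k)
    (hE : EndFree lay k c) {u v : Finset V} (hc : c u v ≠ 0) {y r : V} {p : ℤ}
    (hs : y + p • e ∈ u) (hr : r ∈ u) (hl : lay r + 1 + 1 = lay y + (p + k : ℤ)) :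
    u = seg y e p (p + k - 1) ∧ v = {y + p • e} ∆ {y + (p + k - 2) • e} := by
  have hL := S.two_k_le
  -- Extend to width `k`, where the shape is known, and then undo the extension.
  obtain ⟨h1, h2, h3⟩ := S.extend_of_endFree hE hc hs hr
    (by rw [hl, S.lay_pt]; push_cast; ring)
  have hl' : lay (r + e) + 1 = lay (y + p • e) + k := by
    rw [map_add, S.lay_e, hl, S.lay_pt]; push_cast; ring
  have h4 := (S.eq_line_of_endFree hk hE h3 (Finset.mem_union_right _ h1)
    (Finset.mem_union_right _ h2) hl').2.2
  obtain ⟨h5, h6⟩ := S.eq_line_of_pt_endFree hk hE h3 (Finset.mem_union_right _ h1)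
    (Finset.mem_union_right _ h2) (by rw [hl', S.lay_pt]; push_cast; ring)
  have hr1 : r = y + (p + k - 2) • e := by
    have : r = y + p • e + ((k : ℤ) - 1) • e - e := by rw [← h4]; abel
    rw [this, show p + (k : ℤ) - 2 = p + ((k - 1) + -1) by ring, add_smul p, add_smul _ (-1),
      neg_one_smul]
    abel
  have hr2 : r + e = y + (p + k - 1) • e := by
    rw [hr1, show p + (k : ℤ) - 1 = p + k - 2 + 1 by ring, add_smul _ 1, one_smul, add_assoc]
  constructor
  · rw [← symmDiff_symmDiff_cancel_right {y + p • e} u, h5,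
      ← S.seg_symmDiff_left y (m := p) (n := p + k - 1) (by omega) (by omega),
      symmDiff_symmDiff_cancel_right]
  · rw [hr2, hr1, pair_eq_symmDiff (S.bond_ne y _ _ (by omega) (by omega) (by omega))] at h6
    rw [← symmDiff_symmDiff_cancel_right ({y + (p + k - 2) • e} ∆ {y + (p + k - 1) • e}) v, h6,
      symmDiff_comm {y + (p + k - 2) • e}, symmDiff_assoc, symmDiff_symmDiff_cancel_left]

/-- The equation of the line `Z X ⋯ X Y`. -/
theorem line_right (S : LayeredSolution lay e J hx w k c) (hk : 2 ≤ k) (hE : EndFree lay k c)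
    (y : V) (p : ℤ) :
    hx * lineCoeff c y e ∅ (p + 1) (p + k - 1) p (p + k - 1) +
      J * (if k = 2 then -1 else 1) *
        lineCoeff c y e ∅ (p + 1) (p + k) (p + 1) (p + k - 1) = 0 := by
  have hL := S.two_k_le
  set u := seg y e (p + 1) (p + k) with hu
  set v : Finset V := {y + p • e} ∆ {y + (p + k - 1) • e} ∆ ∅ with hv
  have hv' : v = {y + p • e} ∆ {y + (p + k - 1) • e} := by
    rw [hv, ← Finset.bot_eq_empty, symmDiff_bot]
  have mem : ∀ i, p ≤ i → i ≤ p + k → (y + i • e ∈ v ↔ ¬ (i = p ↔ i = p + k - 1)) :=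
    fun i _ _ => by rw [hv']; exact S.pt_mem_pair y (by omega) (by omega) (by omega) (by omega)
  have hpv : y + p • e ∈ v := (mem p (by omega) (by omega)).2 (by omega)
  have hqv : y + (p + k - 1) • e ∈ v := (mem _ (by omega) (by omega)).2 (by omega)
  have hqu : y + (p + k - 1) • e ∈ u := mem_seg.2 ⟨p + k - 1, by omega, by omega, rfl⟩
  have hlay : lay (y + (p + k - 1) • e) + 1 = lay (y + p • e) + k := by
    rw [S.lay_pt, S.lay_pt]; push_cast; ring
  have h3 : y + (p + 1) • e ∈ u := mem_seg.2 ⟨p + 1, by omega, by omega, rfl⟩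
  have h4 : y + p • e ∉ u := by rw [hu, S.pt_mem_seg (by omega) (by omega)]; omega
  have key := S.eqn_of_vanish (u := u) (v := v) {y + (p + k - 1) • e}
    {{y + (p + 1) • e, y + p • e}} (by simpa using hqv)
    (fun t ht htX => by
      by_contra hc
      simp only [Finset.mem_singleton] at htX
      have h5 : y + (p + k - 1) • e ∈ u ∆ {t} :=
        Finset.mem_symmDiff.2 (Or.inl ⟨hqu, by simpa using Ne.symm htX⟩)
      exact (hE _ _ hc _ _ (Finset.mem_union_right _ hpv) (Finset.mem_union_left _ h5) hlay).2 h5)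
    (fun T hT hTu hTZ => by
      by_contra hc
      simp only [Finset.mem_singleton] at hTZ
      rcases S.end_cases hT hTu hpv (by omega) (by omega) (by omega) with h | ⟨-, h⟩ | ⟨h, -⟩
      · exact (hE _ _ hc _ _ h (Finset.mem_union_left _ hqu) hlay).2 hqu
      · exact hTZ (by rw [h, add_sub_cancel_right])
      · omega)
  rw [Finset.sum_singleton, Finset.sum_singleton, zterm_pair h3 h4, if_pos hqu,
    S.w_pt_swap y _ _ rfl, pair_eq_symmDiff (S.bond_ne y (p + 1) p (by omega) (by omega) (by omega)),
    symmDiff_comm {y + (p + 1) • e}, hv,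
    symmDiff_cancel_fst, ← hv, hu, S.seg_symmDiff_pred y (by omega) (by omega)] at key
  -- For `k = 2` the site after the leading `Z` is the final `Y` itself.
  have hsign : (if y + (p + 1) • e ∈ v then (-1 : ℂ) else 1) = if k = 2 then -1 else 1 := by
    refine if_congr ?_ rfl rfl
    rw [mem _ (by omega) (by omega)]; omega
  rw [hsign] at key
  simp only [lineCoeff, ← hv]
  linear_combination key

/-- The equation of the line `Y X ⋯ X Z`. -/
theorem line_left (S : LayeredSolution lay e J hx w k c) (hk : 2 ≤ k) (hE : EndFree lay k c)
    (y : V) (p : ℤ) :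
    hx * lineCoeff c y e ∅ (p + 1) (p + k - 1) p (p + k - 1) +
      J * (if k = 2 then -1 else 1) *
        lineCoeff c y e ∅ p (p + k - 1) p (p + k - 2) = 0 := by
  have := S.reflect.line_right hk hE.reflect y (-(p + k - 1))
  simp only [lineCoeff_neg] at this
  convert this using 3 <;> first | omega | (congr 1 <;> omega)

/-- The equation of the line `Z X ⋯ X Z` multiplied by an in-layer bond. -/
theorem bent_line (S : LayeredSolution lay e J hx w k c) (hE : EndFree lay k c) {y g : V}
    (hg : lay g = 0) (hg0 : g ≠ 0) {p : ℤ} (h1 : 2 - k ≤ p) (h2 : p ≤ -1) :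
    -w {y, y + g} * lineCoeff c y e ∅ (p + 1) (p + k - 1) p (p + k - 1) +
      J * (if p = -1 then -1 else 1) *
        lineCoeff c y e {y, y + g} (p + 1) (p + k - 1) (p + 1) (p + k - 1) +
      J * (if p = 2 - k then -1 else 1) *
        lineCoeff c y e {y, y + g} (p + 1) (p + k - 1) p (p + k - 2) = 0 := by
  have hk : 2 ≤ k := by omega
  have hL := S.two_k_le
  set u := seg y e (p + 1) (p + k - 1) with hu
  set v : Finset V := {y + p • e} ∆ {y + (p + k - 1) • e} ∆ {y, y + g} with hv
  have mem : ∀ i, p ≤ i → i ≤ p + k → (y + i • e ∈ v ↔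
      ¬ (¬ (i = p ↔ i = p + k - 1) ↔ i = 0)) := fun i _ _ =>
    S.pt_mem_bent hg hg0 (by omega) (by omega) (by omega) (by omega) (by omega) (by omega)
  have hpv : y + p • e ∈ v := (mem p (by omega) (by omega)).2 (by omega)
  have hqv : y + (p + k - 1) • e ∈ v := (mem _ (by omega) (by omega)).2 (by omega)
  have hlay : lay (y + (p + k - 1) • e) + 1 = lay y + (p + k : ℤ) := by
    rw [S.lay_pt]; push_cast; ring
  have hyv : y ∈ v := (S.base_mem_bent hg hg0 (by omega) (by omega) (by omega) (by omega)).2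
    (by omega)
  have hyu : y ∈ u := base_mem_seg (by omega) (by omega)
  have hgu : y + g ∉ u := S.offset_notMem_seg hg hg0 (by omega) (by omega)
  have h3 : y + (p + 1) • e ∈ u := mem_seg.2 ⟨p + 1, by omega, by omega, rfl⟩
  have h4 : y + p • e ∉ u := by rw [hu, S.pt_mem_seg (by omega) (by omega)]; omega
  have h5 : y + (p + k - 2) • e ∈ u := mem_seg.2 ⟨p + k - 2, by omega, by omega, rfl⟩
  have h6 : y + (p + k - 1) • e ∉ u := by rw [hu, S.pt_mem_seg (by omega) (by omega)]; omega
  have hne : ({y + (p + 1) • e, y + p • e} : Finset V) ≠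
      {y + (p + k - 2) • e, y + (p + k - 1) • e} := fun h => by
    have : y + p • e ∈ ({y + (p + 1) • e, y + p • e} : Finset V) := by simp
    rw [h] at this
    simp only [Finset.mem_insert, Finset.mem_singleton] at this
    rcases this with this | this
    · exact S.bond_ne y p (p + k - 2) (by omega) (by omega) (by omega) this
    · exact S.bond_ne y p (p + k - 1) (by omega) (by omega) (by omega) this
  have key := S.eqn_of_vanish (u := u) (v := v) ∅
    {{y, y + g}, {y + (p + 1) • e, y + p • e}, {y + (p + k - 2) • e, y + (p + k - 1) • e}}
    (by simp)
    (fun t ht _ => by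
      by_contra hc
      exact symmDiff_singleton_ne u t (S.eq_line_of_pt_endFree hk hE hc
        (Finset.mem_union_right _ hpv) (Finset.mem_union_right _ hqv) hlay).1)
    (fun T hT hTu hTZ => by
      by_contra hc
      simp only [Finset.mem_insert, Finset.mem_singleton, not_or] at hTZ
      rcases S.end_cases hT hTu hpv (by omega) (by omega) (by omega) with h | ⟨-, h⟩ | ⟨h, -⟩
      · rcases S.end_cases hT hTu hqv (by omega) (by omega) (by omega) with
          h' | ⟨h', -⟩ | ⟨-, h'⟩
        · have := (S.eq_line_of_pt_endFree hk hE hc h h' hlay).2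
          rw [hv, symmDiff_assoc, symmDiff_eq_left, symmDiff_eq_bot] at this
          exact hTZ.1 this.symm
        · omega
        · exact hTZ.2.2 (by rw [h', show p + (k : ℤ) - 1 - 1 = p + k - 2 by ring])
      · exact hTZ.2.1 (by rw [h, add_sub_cancel_right])
      · omega)
  rw [Finset.sum_empty, Finset.sum_insert (by
      simp only [Finset.mem_insert, Finset.mem_singleton, not_or]
      exact ⟨S.offset_ne_bond hg hg0 (by omega) (by omega) (by omega) (by omega),
        S.offset_ne_bond hg hg0 (by omega) (by omega) (by omega) (by omega)⟩),
    Finset.sum_pair hne, zterm_pair hyu hgu, zterm_pair h3 h4, zterm_pair h5 h6, if_pos hyv,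
    S.w_pt_swap y _ _ rfl, S.w_pt y (p + k - 2) _ (by ring),
    pair_eq_symmDiff (S.bond_ne y (p + 1) p (by omega) (by omega) (by omega)),
    pair_eq_symmDiff (S.bond_ne y (p + k - 2) (p + k - 1) (by omega) (by omega) (by omega)),
    symmDiff_comm {y + (p + 1) • e}, symmDiff_comm {y + (p + k - 2) • e}, hv,
    symmDiff_symmDiff_cancel_right, symmDiff_cancel_fst, symmDiff_cancel_snd, ← hv] at key
  have hsign : (if y + (p + 1) • e ∈ v then (-1 : ℂ) else 1) = if p = -1 then -1 else 1 := by
    refine if_congr ?_ rfl rfl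
    rw [mem _ (by omega) (by omega)]; omega
  have hsign' : (if y + (p + k - 2) • e ∈ v then (-1 : ℂ) else 1) =
      if p = 2 - k then -1 else 1 := by
    refine if_congr ?_ rfl rfl
    rw [mem _ (by omega) (by omega)]; omega
  rw [hsign, hsign'] at key
  simp only [lineCoeff, ← Finset.bot_eq_empty, symmDiff_bot]
  linear_combination key

/-- The equation of the line `Y X ⋯ X Y` of width `k - 1` multiplied by an in-layer bond. -/
theorem bent_short_line (S : LayeredSolution lay e J hx w k c) (hk : 3 ≤ k)
    (hE : EndFree lay k c) {y g : V} (hg : lay g = 0) (hg0 : g ≠ 0) {p : ℤ} (h1 : 2 - k ≤ p)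
    (h2 : p ≤ 0) :
    w {y, y + g} * (if p = 0 ∨ p = 2 - k then 1 else -1) *
        lineCoeff c y e ∅ p (p + k - 1) p (p + k - 2) +
      hx * (if p = 0 then 0 else
        lineCoeff c y e {y, y + g} (p + 1) (p + k - 1) p (p + k - 2)) +
      hx * (if p = 2 - k then 0 else
        lineCoeff c y e {y, y + g} p (p + k - 2) p (p + k - 2)) = 0 := by
  have hL := S.two_k_le
  set u := seg y e p (p + k - 1) with hu
  set v : Finset V := {y + p • e} ∆ {y + (p + k - 2) • e} ∆ {y, y + g} with hv
  have mem : ∀ i, p ≤ i → i ≤ p + k → (y + i • e ∈ v ↔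
      ¬ (¬ (i = p ↔ i = p + k - 2) ↔ i = 0)) := fun i _ _ =>
    S.pt_mem_bent hg hg0 (by omega) (by omega) (by omega) (by omega) (by omega) (by omega)
  have hlay : lay (y + (p + k - 2) • e) + 1 + 1 = lay y + (p + k : ℤ) := by
    rw [S.lay_pt]; push_cast; ring
  have hyu : y ∈ u := base_mem_seg (by omega) (by omega)
  have hgu : y + g ∉ u := S.offset_notMem_seg hg hg0 (by omega) (by omega)
  have h3 : y + p • e ∈ u := mem_seg.2 ⟨p, by omega, by omega, rfl⟩
  have h4 : y + (p + k - 2) • e ∈ u := mem_seg.2 ⟨p + k - 2, by omega, by omega, rfl⟩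
  have key := S.eqn_of_vanish (u := u) (v := v)
    -- The filter drops an end site that coincides with `y`: the in-layer bond has removed its `Z`
    -- part, so no X-term acts there.
    (({y + p • e, y + (p + k - 2) • e} : Finset V).filter (· ∈ v)) {{y, y + g}}
    (fun t ht => (Finset.mem_filter.1 ht).2)
    (fun t ht htX => by
      by_contra hc
      have htX : t ≠ y + p • e ∧ t ≠ y + (p + k - 2) • e := by
        simpa [Finset.mem_filter, ht] using htX
      exact symmDiff_singleton_ne u t (S.eq_short_line_of_endFree (by omega) hE hc
        (Finset.mem_symmDiff.2 (Or.inl ⟨h3, by simpa using htX.1.symm⟩))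
        (Finset.mem_symmDiff.2 (Or.inl ⟨h4, by simpa using htX.2.symm⟩)) hlay).1)
    (fun T hT hTu hTZ => by
      by_contra hc
      have := (S.eq_short_line_of_endFree (by omega) hE hc h3 h4 hlay).2
      rw [hv, symmDiff_assoc, symmDiff_eq_left, symmDiff_eq_bot] at this
      exact hTZ (Finset.mem_singleton.2 this.symm))
  rw [Finset.sum_singleton, zterm_pair hyu hgu, Finset.sum_filter,
    Finset.sum_pair (S.bond_ne y _ _ (by omega) (by omega) (by omega)), if_pos h3, if_pos h4, hv,
    symmDiff_symmDiff_cancel_right, ← hv, hu, S.seg_symmDiff_left y (by omega) (by omega),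
    show p + (k : ℤ) - 2 = p + k - 1 - 1 by ring, S.seg_symmDiff_pred y (by omega) (by omega),
    show p + (k : ℤ) - 1 - 1 = p + k - 2 by ring] at key
  have s1 : y ∈ v ↔ ¬ (p = 0 ∨ p = 2 - k) := by
    rw [hv, S.base_mem_bent hg hg0 (by omega) (by omega) (by omega) (by omega)]; omega
  have s2 : y + p • e ∈ v ↔ ¬ p = 0 := by rw [mem _ (by omega) (by omega)]; omega
  have s3 : y + (p + k - 2) • e ∈ v ↔ ¬ p = 2 - k := by rw [mem _ (by omega) (by omega)]; omega
  simp only [s1, s2, s3, ite_not, one_mul] at key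
  simp only [lineCoeff, ← hv, ← Finset.bot_eq_empty, symmDiff_bot]
  linear_combination key

/-- A line `Z X ⋯ X Z` is tied by `line_right` to the `Y X ⋯ X Y` without its first site and by
`line_left` to the one without its last site, so neighbouring short lines agree. -/
theorem line_const (S : LayeredSolution lay e J hx w k c) (hk : 2 ≤ k) (hE : EndFree lay k c)
    (y : V) (p : ℤ) :
    lineCoeff c y e ∅ p (p + k - 1) p (p + k - 2) = lineCoeff c y e ∅ 0 (k - 1) 0 (k - 2) := by
  have hs : (if k = 2 then (-1 : ℂ) else 1) ≠ 0 := by split_ifs <;> simp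
  have step : ∀ p : ℤ, lineCoeff c y e ∅ (p + 1) (p + 1 + k - 1) (p + 1) (p + 1 + k - 2) =
      lineCoeff c y e ∅ p (p + k - 1) p (p + k - 2) := fun p => by
    have h1 := S.line_right hk hE y p
    have h2 := S.line_left hk hE y p
    rw [show p + 1 + (k : ℤ) - 1 = p + k by ring, show p + 1 + (k : ℤ) - 2 = p + k - 1 by ring]
    refine mul_left_cancel₀ (mul_ne_zero S.J_ne hs) ?_
    linear_combination h1 - h2
  induction p using Int.induction_on with
  | zero => simp
  | succ i ih => rw [step, ih]
  | pred i ih => rw [← ih, ← step (-(i : ℤ) - 1), sub_add_cancel]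

/-- For `k ≥ 3` the lines `Z X ⋯ X Z` have coefficient zero. -/
theorem line_eq_zero (S : LayeredSolution lay e J hx w k c) (hk : 3 ≤ k)
    (hE : EndFree lay k c) {y g : V} (hg : lay g = 0) (hg0 : g ≠ 0) (hw : w {y, y + g} ≠ 0) :
    lineCoeff c y e ∅ 1 (k - 1) 0 (k - 1) = 0 := by
  have hk2 : ¬ k = 2 := by omega
  set ε := lineCoeff c y e ∅ 0 (k - 1) 0 (k - 2) with hε
  set ζ := lineCoeff c y e ∅ 1 (k - 1) 0 (k - 1) with hζ
  set W := w {y, y + g} with hW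
  have he := S.line_const (by omega) hE y
  rw [← hε] at he
  have hζε : hx * ζ + J * ε = 0 := by
    have := S.line_left (by omega) hE y 0
    rw [he, if_neg hk2] at this
    simpa using this
  have hz : ∀ p : ℤ, lineCoeff c y e ∅ (p + 1) (p + k - 1) p (p + k - 1) = ζ := fun p => by
    have := S.line_left (by omega) hE y p
    rw [he, if_neg hk2] at this
    refine mul_left_cancel₀ S.hx_ne ?_
    linear_combination this - hζε
  -- `A` and `B` belong to bent strings `Z X ⋯ X Y` and `Y X ⋯ X Z` of width `k - 1`; the equations
  -- `e1` and `e2` lead alternately from one to the other.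
  set A : ℤ → ℂ := fun p => lineCoeff c y e {y, y + g} (p + 1) (p + k - 1) p (p + k - 2) with hA
  set B : ℤ → ℂ := fun q => lineCoeff c y e {y, y + g} q (q + k - 2) q (q + k - 2) with hB
  have e1 : ∀ p : ℤ, 2 - (k : ℤ) ≤ p → p ≤ -1 →
      -W * ζ + J * (if p = -1 then -1 else 1) * B (p + 1) +
        J * (if p = 2 - k then -1 else 1) * A p = 0 := fun p h1 h2 => by
    have := S.bent_line hE (y := y) hg hg0 h1 h2
    rw [hz] at this
    simp only [hA, hB]
    rw [show p + 1 + (k : ℤ) - 2 = p + k - 1 by ring]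
    exact this
  have e2 : ∀ p : ℤ, 2 - (k : ℤ) ≤ p → p ≤ 0 → W * (if p = 0 ∨ p = 2 - k then 1 else -1) * ε +
      hx * (if p = 0 then 0 else A p) + hx * (if p = 2 - k then 0 else B p) = 0 :=
    fun p h1 h2 => by
      have := S.bent_short_line hk hE (y := y) hg hg0 h1 h2
      rwa [he] at this
  have f0 := e2 0 (by omega) le_rfl
  rw [if_pos (Or.inl rfl), if_pos rfl, if_neg (by omega)] at f0
  have main : ∀ n : ℕ, 1 ≤ n → n + 2 ≤ k →
      J * hx * (if -(n : ℤ) = 2 - k then -1 else 1) * A (-n) = 2 * n * (W * ζ * hx) := by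
    intro n hn
    induction n, hn using Nat.le_induction with
    | base =>
      intro _
      have := e1 (-1) (by omega) le_rfl
      rw [if_pos rfl, neg_add_cancel] at this
      push_cast
      linear_combination hx * this + J * f0 - W * hζε
    | succ n hn ih =>
      intro hnk
      have h1 := ih (by omega)
      have h2 := e2 (-n) (by omega) (by omega)
      have h3 := e1 (-(n + 1 : ℕ)) (by omega) (by omega)
      rw [if_neg (by omega)] at h1
      rw [if_neg (by omega), if_neg (by omega), if_neg (by omega)] at h2
      rw [if_neg (c := -((n + 1 : ℕ) : ℤ) = -1) (by omega),
        show -((n + 1 : ℕ) : ℤ) + 1 = -n by push_cast; ring] at h3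
      push_cast at h3 ⊢
      linear_combination hx * h3 - J * h2 + h1 - W * hζε
  have h1 := main (k - 2) (by omega) (by omega)
  have h2 := e2 (2 - k) le_rfl (by omega)
  rw [if_pos (Or.inr rfl), if_neg (by omega), if_pos rfl] at h2
  rw [show (-((k - 2 : ℕ) : ℤ)) = 2 - k by push_cast [Nat.cast_sub (show 2 ≤ k by omega)]; ring,
    if_pos rfl, Nat.cast_sub (by omega)] at h1
  -- At the far end `e2` gives `J * hx * A (2 - k) = W * ζ * hx`, whereas the chain gives `-2 * (k -
  -- 2)` times that amount.
  have h3 : ((2 * k - 3 : ℕ) : ℂ) * (W * ζ * hx) = 0 := by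
    rw [Nat.cast_sub (by omega)]
    push_cast at h1 ⊢
    linear_combination -h1 - J * h2 + W * hζε
  have h4 := (mul_eq_zero.1 h3).resolve_left (Nat.cast_ne_zero.2 (by omega))
  exact (mul_eq_zero.1 ((mul_eq_zero.1 h4).resolve_right S.hx_ne)).resolve_left hw

/-! ### Reducing the width, and the cases `k = 2` and `k = 1`. -/

theorem narrow (S : LayeredSolution lay e J hx w k c) (hk : 2 ≤ k)
    (h : ∀ u v, c u v ≠ 0 → ∀ s r, s ∈ u ∪ v → r ∈ u ∪ v → lay r + 1 = lay s + k → False)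
    {u v : Finset V} (hc : c u v ≠ 0) :
    ∃ x₀ : ZMod L, ∀ t ∈ u ∪ v, ∃ j : ℕ, j < k - 1 ∧ lay t = x₀ + j := by
  obtain ⟨x, hx⟩ := S.width u v hc
  -- If the first layer of the window is occupied, the last is not; otherwise the window can start
  -- one layer later.
  by_cases hs : ∃ s ∈ u ∪ v, lay s = x
  · obtain ⟨s, hs, hsx⟩ := hs
    refine ⟨x, fun t ht => ?_⟩
    obtain ⟨j, hj, hjl⟩ := hx t ht
    refine ⟨j, ?_, hjl⟩
    by_contra hjk
    obtain rfl : k = j + 1 := by omega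
    exact h u v hc s t hs ht (by rw [hjl, hsx]; push_cast; ring)
  · push Not at hs
    refine ⟨x + 1, fun t ht => ?_⟩
    obtain ⟨j, hj, hjl⟩ := hx t ht
    rcases j with _ | j
    · exact absurd (by simpa using hjl) (hs t ht)
    · exact ⟨j, by omega, by rw [hjl]; push_cast; ring⟩

/-- No conserved coefficients have exact width `k ≥ 3`. -/
theorem narrow_of_three_le (S : LayeredSolution lay e J hx w k c) (hk : 3 ≤ k) {g : V}
    (hg : lay g = 0) (hg0 : g ≠ 0) (hw : ∀ y, w {y, y + g} ≠ 0) {u v : Finset V}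
    (hc : c u v ≠ 0) :
    ∃ x₀ : ZMod L, ∀ t ∈ u ∪ v, ∃ j : ℕ, j < k - 1 ∧ lay t = x₀ + j := by
  have hE := S.endFree (by omega) hg hg0 hw
  have hL := S.two_k_le
  refine S.narrow (by omega) (fun u v hc s r hs hr hl => ?_) hc
  obtain ⟨rfl, rfl, -⟩ := S.eq_line_of_endFree (by omega) hE hc hs hr hl
  have h1 := S.line_eq_zero hk hE hg hg0 (hw s)
  have h2 := S.bond_ne s 0 (k - 1) (by omega) (by omega) (by omega)
  rw [lineCoeff, ← Finset.bot_eq_empty, symmDiff_bot, ← pair_eq_symmDiff h2, zero_smul,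
    add_zero] at h1
  exact hc h1

/-- For `k = 2` the short line degenerates to a single `X`, its two `Z` factors cancelling, so
`line_const` applies. -/
theorem coeff_X_add (S : LayeredSolution lay e J hx w 2 c) (hE : EndFree lay 2 c) (y : V) :
    c {y + e} ∅ = c {y} ∅ := by
  have h := S.line_const le_rfl hE y 1
  have e1 : ∀ n : ℤ, seg y e n (n + 1) = {y + n • e} := fun n => by
    have : Finset.Ico n (n + 1) = {n} := by ext; simp; omega
    simp [seg, this]
  have e2 := e1 1
  have e3 := e1 0
  norm_num at e2 e3
  norm_num [lineCoeff, e2, e3] at h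
  exact h

/-- For `k = 2` a string with `X` or `Y` on `y` can only be a lone `X` there, which leaves two terms
in the equation of the string with `Y` on `y` and `Z` on `y + g`. -/
theorem coeff_X_eq (S : LayeredSolution lay e J hx w 2 c) (hE : EndFree lay 2 c) {y g : V}
    (hg0 : g ≠ 0) : w {y, y + g} * c {y} ∅ = hx * c ∅ {y, y + g} := by
  have hpt : ∀ {u v : Finset V}, c u v ≠ 0 → y ∈ u → u = {y} ∧ v = ∅ := fun hc hy => by
    have e3 : seg y e 0 1 = {y} := by
      have : Finset.Ico (0 : ℤ) 1 = {0} := by ext; simp; omega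
      simp [seg, this]
    have := S.eq_short_line_of_endFree le_rfl hE hc (y := y) (r := y) (p := 0) (by simpa using hy)
      hy (by push_cast; ring)
    norm_num [e3] at this
    exact this
  have hgy : y + g ∉ ({y} : Finset V) := by simpa using hg0
  have key := S.eqn_of_vanish (u := {y}) (v := {y, y + g}) {y} {{y, y + g}} (by simp)
    (fun t ht htX => by
      by_contra hc
      refine symmDiff_singleton_ne _ t (hpt hc ?_).1
      exact Finset.mem_symmDiff.2 (Or.inl ⟨by simp, by
        simpa [eq_comm] using htX⟩))
    (fun T hT hTu hTZ => by
      by_contra hc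
      have := (hpt hc (by simp)).2
      rw [← Finset.bot_eq_empty, symmDiff_eq_bot] at this
      exact hTZ (Finset.mem_singleton.2 this.symm))
  rw [Finset.sum_singleton, Finset.sum_singleton, zterm_pair (by simp) hgy, if_pos (by simp),
    if_pos (by simp), symmDiff_self, symmDiff_self, Finset.bot_eq_empty] at key
  linear_combination -key

/-- The pair `{y, y + g}` is symmetric, so its coefficient determines both single-`X` coefficients
in the same way. -/
theorem coeff_X_add_offset (S : LayeredSolution lay e J hx w 2 c) (hE : EndFree lay 2 c) {y g : V}
    (hg0 : g ≠ 0) (hw : w {y, y + g} ≠ 0) : c {y + g} ∅ = c {y} ∅ := by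
  have h1 := S.coeff_X_eq hE (y := y) hg0
  have h2 := S.coeff_X_eq hE (y := y + g) (g := -g) (by simpa using hg0)
  rw [add_neg_cancel_right, Finset.pair_comm] at h2
  refine mul_left_cancel₀ hw ?_
  rw [h1, h2]

/-- Conserved coefficients of width two that vanish on all `X t` have width one. -/
theorem narrow_of_two (S : LayeredSolution lay e J hx w 2 c) (hE : EndFree lay 2 c)
    (hX : ∀ y, c {y} ∅ = 0) {u v : Finset V} (hc : c u v ≠ 0) :
    ∃ x₀ : ZMod L, ∀ t ∈ u ∪ v, ∃ j : ℕ, j < 1 ∧ lay t = x₀ + j := by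
  have hL := S.two_k_le
  refine S.narrow le_rfl (fun u v hc s r hs hr hl => ?_) hc
  obtain ⟨rfl, rfl, -⟩ := S.eq_line_of_endFree le_rfl hE hc hs hr hl
  have h1 := S.line_left le_rfl hE s 0
  have e3 : seg s e 0 1 = {s} := by
    have : Finset.Ico (0 : ℤ) 1 = {0} := by ext; simp; omega
    simp [seg, this]
  have h2 := S.bond_ne s 0 1 (by omega) (by omega) (by omega)
  norm_num at h2
  norm_num [lineCoeff, e3, hX, S.hx_ne] at h1
  rw [← Finset.bot_eq_empty, symmDiff_bot] at h1
  norm_num [pair_eq_symmDiff, h2] at hc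
  exact hc h1

/-- Conserved coefficients of width one are supported on the identity. -/
theorem eq_zero_of_width_one (S : LayeredSolution lay e J hx w 1 c) {u v : Finset V}
    (huv : u ≠ ∅ ∨ v ≠ ∅) : c u v = 0 := by
  have hL := S.two_k_le
  have hu0 : ∀ {u v : Finset V}, c u v ≠ 0 → u = ∅ := by
    intro u v hc
    by_contra hu
    obtain ⟨r, hr⟩ := Finset.nonempty_iff_ne_empty.2 hu
    have hl : lay (r + e) = lay r + (1 : ℕ) := by rw [map_add, S.lay_e, Nat.cast_one]
    have hr' : ∀ {v : Finset V}, r ∈ u ∪ v := Finset.mem_union_left _ hr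
    have hre : r + e ∉ u ∪ v := fun h => S.far hc hr' h hl
    have hreu : r + e ∉ u := fun h => hre (Finset.mem_union_left _ h)
    have hrev : r + e ∉ v := fun h => hre (Finset.mem_union_right _ h)
    have hreB : r + e ∈ v ∆ {r, r + e} := by simp [Finset.mem_symmDiff, hrev]
    have hbox : ∀ a ∈ u, lay a = lay r := fun a ha => by
      obtain ⟨j, hj, h⟩ := S.box hc hr' hr' (by simp) (Finset.mem_union_left v ha)
      obtain rfl : j = 0 := by omega
      simpa using h
    rcases S.exists_other_of_pair hc hr hreu (by rw [S.w_bond]; exact S.J_ne) with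
      ⟨t, ht, hct⟩ | ⟨T, hT, hTu, hTne, hcT⟩
    · refine S.far hct (t₀ := r) (t₁ := r + e) ?_ (Finset.mem_union_right _ hreB) hl
      by_cases hrt : r = t
      · rw [← hrt] at ht; exact Finset.mem_union_right _ ht
      · exact Finset.mem_union_left _ (Finset.mem_symmDiff.2 (Or.inl ⟨hr, by simpa using hrt⟩))
    · rcases S.mem_or_removed hT hTu (Finset.mem_union_right u hreB) with
        h | ⟨a, ha, -, -, hTa, h⟩
      · exact S.far hcT hr' h hl
      rcases h with h | h | h
      · rw [hbox a ha] at h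
        exact lay_ne (n := 1) (by omega) (by omega) (h.symm.trans hl)
      · rw [← add_right_cancel h] at hTa; exact hTne hTa
      · have h1 := hbox a ha
        rw [h, map_add, map_add, S.lay_e] at h1
        -- For `L = 2` the site two steps ahead is `r` itself and the bond is the one already used;
        -- for larger `L` its layer differs from that of `r`.
        by_cases h2 : L = 2
        · have h3 : e + e = 0 := by
            have := S.nsmul_e
            rwa [h2, two_nsmul] at this
          rw [add_assoc, h3, add_zero] at h
          rw [h] at hTa; exact hTne hTa
        · refine lay_ne (x := lay r) (n := 2) (by omega) (by omega) ?_
          rw [← h1]; push_cast; linear_combination -h1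
  by_contra hc
  obtain rfl := hu0 hc
  obtain ⟨r, hr⟩ := Finset.nonempty_iff_ne_empty.2 (huv.resolve_left (by simp))
  rcases S.exists_other_of_site hc hr with ⟨t, ht, htr, hct⟩ | ⟨T, hT, hTu, hcT⟩
  · have := hu0 hct
    rw [← Finset.bot_eq_empty, bot_symmDiff, symmDiff_eq_bot, Finset.singleton_inj] at this
    exact htr this.symm
  · have := hu0 hcT
    rw [← Finset.bot_eq_empty, bot_symmDiff] at this
    simp at this

end LayeredSolution

/-! ### Products, traces and commutators of Pauli strings. -/

section Matrices

variable {d L : ℕ} [NeZero L]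

theorem pauliProduct_mul_apply (A B : PauliString d L) (s t : Site d L → Fin 2) :
    (pauliProduct A * pauliProduct B) s t =
      ∏ r, ((A r).toMatrix * (B r).toMatrix) (s r) (t r) := by
  simp only [Matrix.mul_apply, pauliProduct, Matrix.of_apply, ← Finset.prod_mul_distrib]
  rw [Finset.prod_univ_sum, Fintype.piFinset_univ]

theorem pauliProduct_one : pauliProduct (fun _ : Site d L => Pauli.I) = 1 := by
  ext s t
  simp only [pauliProduct, Matrix.of_apply, Pauli.toMatrix, Matrix.one_apply]
  by_cases h : s = t
  · subst h; simp
  · rw [if_neg h]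
    obtain ⟨r, hr⟩ := Function.ne_iff.1 h
    exact Finset.prod_eq_zero (Finset.mem_univ r) (by simp [hr])

theorem onSite_mul {a b : Pauli} {φ : ℂ} {B : PauliString d L} {t : Site d L}
    (h : a.toMatrix * (B t).toMatrix = φ • b.toMatrix) :
    onSite a t * pauliProduct B = φ • pauliProduct (Function.update B t b) := by
  ext s s'
  rw [onSite, pauliProduct_mul_apply, Matrix.smul_apply, pauliProduct, Matrix.of_apply,
    ← Finset.mul_prod_erase Finset.univ _ (Finset.mem_univ t),
    ← Finset.mul_prod_erase Finset.univ (fun r => (Function.update B t b r).toMatrix (s r) (s' r))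
      (Finset.mem_univ t), Function.update_self, Function.update_self, h, Matrix.smul_apply,
    smul_mul_assoc]
  congr 2
  refine Finset.prod_congr rfl fun r hr => ?_
  rw [Function.update_of_ne (Finset.ne_of_mem_erase hr),
    Function.update_of_ne (Finset.ne_of_mem_erase hr)]
  simp [Pauli.toMatrix]

theorem mul_onSite {a b : Pauli} {φ : ℂ} {B : PauliString d L} {t : Site d L}
    (h : (B t).toMatrix * a.toMatrix = φ • b.toMatrix) :
    pauliProduct B * onSite a t = φ • pauliProduct (Function.update B t b) := by
  ext s s'
  rw [onSite, pauliProduct_mul_apply, Matrix.smul_apply, pauliProduct, Matrix.of_apply,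
    ← Finset.mul_prod_erase Finset.univ _ (Finset.mem_univ t),
    ← Finset.mul_prod_erase Finset.univ (fun r => (Function.update B t b r).toMatrix (s r) (s' r))
      (Finset.mem_univ t), Function.update_self, Function.update_self, h, Matrix.smul_apply,
    smul_mul_assoc]
  congr 2
  refine Finset.prod_congr rfl fun r hr => ?_
  rw [Function.update_of_ne (Finset.ne_of_mem_erase hr),
    Function.update_of_ne (Finset.ne_of_mem_erase hr)]
  simp [Pauli.toMatrix]

theorem trace_pauliProduct_mul (A B : PauliString d L) :
    (pauliProduct A * pauliProduct B).trace =
      if A = B then (2 : ℂ) ^ Fintype.card (Site d L) else 0 := by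
  have h1 : (pauliProduct A * pauliProduct B).trace =
      ∏ r, ((A r).toMatrix * (B r).toMatrix).trace := by
    simp only [Matrix.trace, Matrix.diag_apply, pauliProduct_mul_apply]
    rw [Finset.prod_univ_sum, Fintype.piFinset_univ]
  have h2 : ∀ a b : Pauli, (a.toMatrix * b.toMatrix).trace = if a = b then 2 else 0 := by
    intro a b
    cases a <;> cases b <;>
      simp [Pauli.toMatrix, Matrix.trace, Fin.sum_univ_two] <;> norm_num
  rw [h1]
  simp only [h2]
  by_cases h : A = B
  · subst h; simp
  · rw [if_neg h]
    obtain ⟨r, hr⟩ := Function.ne_iff.1 h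
    exact Finset.prod_eq_zero (Finset.mem_univ r) (by simp [hr])

theorem trace_sum_mul_pauliProduct (c : PauliString d L → ℂ) (B : PauliString d L) :
    ((∑ A, c A • pauliProduct A) * pauliProduct B).trace =
      (2 : ℂ) ^ Fintype.card (Site d L) * c B := by
  rw [Finset.sum_mul, Matrix.trace_sum]
  simp only [smul_mul_assoc, Matrix.trace_smul, trace_pauliProduct_mul, smul_eq_mul, mul_ite,
    mul_zero, Finset.sum_ite_eq', Finset.mem_univ, if_true]
  ring

/-- The Pauli string with `X`/`Y` on `u` and `Y`/`Z` on `v`. -/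
def strOf (u v : Finset (Site d L)) : PauliString d L := fun t =>
  if t ∈ u then if t ∈ v then Pauli.Y else Pauli.X else if t ∈ v then Pauli.Z else Pauli.I

theorem strOf_symmDiff_left {d L : ℕ} (u v : Finset (Site d L)) (t : Site d L) :
    strOf (u ∆ {t}) v = Function.update (strOf u v) t
      (if t ∈ u then if t ∈ v then Pauli.Z else Pauli.I else
        if t ∈ v then Pauli.Y else Pauli.X) := by
  ext r
  by_cases h : r = t
  · subst h
    by_cases h1 : r ∈ u <;> by_cases h2 : r ∈ v <;> simp [strOf, Finset.mem_symmDiff, h1, h2]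
  · simp [strOf, Finset.mem_symmDiff, h]

theorem strOf_symmDiff_right {d L : ℕ} (u v : Finset (Site d L)) (t : Site d L) :
    strOf u (v ∆ {t}) = Function.update (strOf u v) t
      (if t ∈ u then if t ∈ v then Pauli.X else Pauli.Y else
        if t ∈ v then Pauli.I else Pauli.Z) := by
  ext r
  by_cases h : r = t
  · subst h
    by_cases h1 : r ∈ u <;> by_cases h2 : r ∈ v <;> simp [strOf, Finset.mem_symmDiff, h1, h2]
  · simp [strOf, Finset.mem_symmDiff, h]

theorem onSite_Z_mul (u v : Finset (Site d L)) (t : Site d L) :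
    onSite Pauli.Z t * pauliProduct (strOf u v) =
      (if t ∈ u then if t ∈ v then -Complex.I else Complex.I else 1) •
        pauliProduct (strOf u (v ∆ {t})) := by
  rw [strOf_symmDiff_right]
  refine onSite_mul ?_
  by_cases h1 : t ∈ u <;> by_cases h2 : t ∈ v <;> simp only [strOf, h1, h2, if_true, if_false] <;>
    ext i j <;> fin_cases i <;> fin_cases j <;> simp [Pauli.toMatrix]

theorem mul_onSite_Z (u v : Finset (Site d L)) (t : Site d L) :
    pauliProduct (strOf u v) * onSite Pauli.Z t =
      (if t ∈ u then if t ∈ v then Complex.I else -Complex.I else 1) •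
        pauliProduct (strOf u (v ∆ {t})) := by
  rw [strOf_symmDiff_right]
  refine mul_onSite ?_
  by_cases h1 : t ∈ u <;> by_cases h2 : t ∈ v <;> simp only [strOf, h1, h2, if_true, if_false] <;>
    ext i j <;> fin_cases i <;> fin_cases j <;> simp [Pauli.toMatrix]

theorem onSite_X_mul (u v : Finset (Site d L)) (t : Site d L) :
    onSite Pauli.X t * pauliProduct (strOf u v) =
      (if t ∈ v then if t ∈ u then Complex.I else -Complex.I else 1) •
        pauliProduct (strOf (u ∆ {t}) v) := by
  rw [strOf_symmDiff_left]
  refine onSite_mul ?_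
  by_cases h1 : t ∈ u <;> by_cases h2 : t ∈ v <;> simp only [strOf, h1, h2, if_true, if_false] <;>
    ext i j <;> fin_cases i <;> fin_cases j <;> simp [Pauli.toMatrix]

theorem mul_onSite_X (u v : Finset (Site d L)) (t : Site d L) :
    pauliProduct (strOf u v) * onSite Pauli.X t =
      (if t ∈ v then if t ∈ u then -Complex.I else Complex.I else 1) •
        pauliProduct (strOf (u ∆ {t}) v) := by
  rw [strOf_symmDiff_left]
  refine mul_onSite ?_
  by_cases h1 : t ∈ u <;> by_cases h2 : t ∈ v <;> simp only [strOf, h1, h2, if_true, if_false] <;>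
    ext i j <;> fin_cases i <;> fin_cases j <;> simp [Pauli.toMatrix]

/-- The sign of the commutator of `∏ t ∈ T, Z t` with the string `strOf u v`. -/
def zSign (u v T : Finset (Site d L)) : ℂ :=
  if (T ∩ u).card = 1 then if Disjoint (T ∩ u) v then 1 else -1 else 0

theorem commutator_X (u v : Finset (Site d L)) (t : Site d L) :
    onSite Pauli.X t * pauliProduct (strOf u v) - pauliProduct (strOf u v) * onSite Pauli.X t =
      (2 * Complex.I * if t ∈ v then if t ∈ u then 1 else -1 else 0) •
        pauliProduct (strOf (u ∆ {t}) v) := by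
  rw [onSite_X_mul, mul_onSite_X, ← sub_smul]
  congr 1
  split_ifs <;> ring

theorem commutator_Z (u v : Finset (Site d L)) (t : Site d L) :
    onSite Pauli.Z t * pauliProduct (strOf u v) - pauliProduct (strOf u v) * onSite Pauli.Z t =
      (2 * Complex.I * zSign u v {t}) • pauliProduct (strOf u (v ∆ {t})) := by
  rw [onSite_Z_mul, mul_onSite_Z, ← sub_smul, zSign]
  congr 1
  by_cases h1 : t ∈ u <;> by_cases h2 : t ∈ v <;> simp [h1, h2] <;> ring

theorem commutator_ZZ (u v : Finset (Site d L)) {r t : Site d L} (h : r ≠ t) :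
    onSite Pauli.Z r * onSite Pauli.Z t * pauliProduct (strOf u v) -
      pauliProduct (strOf u v) * (onSite Pauli.Z r * onSite Pauli.Z t) =
      (2 * Complex.I * zSign u v {r, t}) • pauliProduct (strOf u (v ∆ {r, t})) := by
  have hv : v ∆ {t} ∆ {r} = v ∆ {r, t} := by
    rw [pair_eq_symmDiff h, symmDiff_assoc,
      symmDiff_comm ({t} : Finset (Site d L))]
  have hv' : v ∆ {r} ∆ {t} = v ∆ {r, t} := by
    rw [pair_eq_symmDiff h, symmDiff_assoc]
  have m1 : r ∈ v ∆ {t} ↔ r ∈ v := by simp [Finset.mem_symmDiff, h]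
  have m2 : t ∈ v ∆ {r} ↔ t ∈ v := by simp [Finset.mem_symmDiff, h.symm]
  rw [mul_assoc, onSite_Z_mul, mul_smul_comm, onSite_Z_mul, ← mul_assoc, mul_onSite_Z,
    smul_mul_assoc, mul_onSite_Z, hv, hv', smul_smul, smul_smul, ← sub_smul, zSign]
  congr 1
  simp only [m1, m2]
  by_cases h1 : r ∈ u <;> by_cases h2 : t ∈ u <;>
    by_cases h3 : r ∈ v <;> by_cases h4 : t ∈ v <;>
    simp [Finset.insert_inter_of_mem, Finset.insert_inter_of_notMem, h, h1, h2, h3, h4] <;> ring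

end Matrices

/-! ### The commutation equations of the lattice Hamiltonian. -/

section Hamiltonian

variable {d L : ℕ} [NeZero L]

/-- The total strength with which `∏ t ∈ T, Z t` occurs in the Hamiltonian. -/
noncomputable def zWeight (J : Fin d → ℝ) (hz : ℝ) (T : Finset (Site d L)) : ℂ :=
  ∑ r : Site d L, ((∑ μ : Fin d, if T = {r, r + unitVec μ} then (J μ : ℂ) else 0) +
    if T = {r} then (hz : ℂ) else 0)

/-- The `Z`-terms of `H` are collected by their set of sites, which absorbs coinciding bonds. -/
theorem sum_zWeight_smul {M : Type*} [AddCommGroup M] [Module ℂ M] (J : Fin d → ℝ) (hz : ℝ)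
    (f : Finset (Site d L) → M) :
    ∑ T, zWeight J hz T • f T =
      ∑ r : Site d L, ((∑ μ : Fin d, (J μ : ℂ) • f {r, r + unitVec μ}) + (hz : ℂ) • f {r}) := by
  simp only [zWeight, Finset.sum_smul]
  rw [Finset.sum_comm]
  refine Finset.sum_congr rfl fun r _ => ?_
  simp only [add_smul, Finset.sum_smul, Finset.sum_add_distrib, ite_smul, zero_smul]
  rw [Finset.sum_comm]
  simp

theorem unitVec_apply_self {d L : ℕ} (μ : Fin d) : (unitVec μ : Site d L) μ = 1 := by simp [unitVec]

theorem unitVec_apply_of_ne {d L : ℕ} {μ ν : Fin d} (h : ν ≠ μ) : (unitVec μ : Site d L) ν = 0 := by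
  simp [unitVec, h]

theorem one_ne_zero_of_two_le {L : ℕ} (hL : 2 ≤ L) : (1 : ZMod L) ≠ 0 := by
  have : Fact (1 < L) := ⟨hL⟩
  exact one_ne_zero

theorem unitVec_ne_zero {d L : ℕ} (hL : 2 ≤ L) (μ : Fin d) : (unitVec μ : Site d L) ≠ 0 := fun h =>
  one_ne_zero_of_two_le hL (by rw [← unitVec_apply_self μ, h]; rfl)

theorem ne_add_unitVec {d L : ℕ} (hL : 2 ≤ L) (r : Site d L) (μ : Fin d) : r ≠ r + unitVec μ := fun h =>
  unitVec_ne_zero hL μ (by simpa using h)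

theorem bond_eq_iff (hL : 2 ≤ L) (y r : Site d L) (μ ν : Fin d) :
    ({y, y + unitVec μ} : Finset (Site d L)) = {r, r + unitVec ν} ↔
      ν = μ ∧ (r = y ∨ L = 2 ∧ r = y + unitVec μ) := by
  have h1 := one_ne_zero_of_two_le hL
  constructor
  · intro h
    have hy : y ∈ ({r, r + unitVec ν} : Finset (Site d L)) := by rw [← h]; simp
    have hy' : y + unitVec μ ∈ ({r, r + unitVec ν} : Finset (Site d L)) := by rw [← h]; simp
    simp only [Finset.mem_insert, Finset.mem_singleton] at hy hy'
    have hμν : ν = μ := by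
      by_contra hne
      have key : y ν = (y + unitVec μ : Site d L) ν := by
        rw [Pi.add_apply, unitVec_apply_of_ne hne, add_zero]
      have hν : r ν ≠ (r + unitVec ν : Site d L) ν := by
        rw [Pi.add_apply, unitVec_apply_self]; simpa using h1
      rcases hy with hy | hy <;> rcases hy' with hy' | hy'
      · exact ne_add_unitVec hL y μ (hy.trans hy'.symm)
      · rw [hy', hy] at key; exact hν key
      · rw [hy', hy] at key; exact hν key.symm
      · exact ne_add_unitVec hL y μ (hy.trans hy'.symm)
    subst hμν
    refine ⟨rfl, ?_⟩
    rcases hy with hy | hy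
    · exact Or.inl hy.symm
    · rcases hy' with hy' | hy'
      · right
        refine ⟨?_, hy'.symm⟩
        have h2 : unitVec ν + unitVec ν = (0 : Site d L) := by
          rw [hy, add_assoc] at hy'; simpa using hy'
        have h3 := congrFun h2 ν
        rw [Pi.add_apply, unitVec_apply_self, Pi.zero_apply, one_add_one_eq_two] at h3
        have h4 : ((2 : ℕ) : ZMod L) = 0 := by exact_mod_cast h3
        exact le_antisymm (Nat.le_of_dvd two_pos ((ZMod.natCast_eq_zero_iff 2 L).1 h4)) hL
      · exact Or.inl (add_right_cancel hy').symm
  · rintro ⟨rfl, rfl | ⟨rfl, rfl⟩⟩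
    · rfl
    · have : (unitVec ν + unitVec ν : Site d 2) = 0 := by
        ext ι; rw [Pi.add_apply]; exact CharTwo.add_self_eq_zero _
      rw [add_assoc, this, add_zero, Finset.pair_comm]

/-- For `L = 2` the bonds in direction `μ` issuing from `y` and from `y + unitVec μ` are the same
set, which doubles the strength. -/
theorem zWeight_bond (hL : 2 ≤ L) (J : Fin d → ℝ) (hz : ℝ) (y : Site d L) (μ : Fin d) :
    zWeight J hz {y, y + unitVec μ} = (if L = 2 then 2 else 1) * (J μ : ℂ) := by
  have hs : ∀ r, ({y, y + unitVec μ} : Finset (Site d L)) ≠ {r} := fun r h => by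
    have := congrArg Finset.card h
    rw [Finset.card_pair (ne_add_unitVec hL y μ), Finset.card_singleton] at this
    omega
  simp only [zWeight, bond_eq_iff hL, hs, if_false, add_zero, ite_and]
  by_cases h2 : L = 2
  · have : ∀ r : Site d L, (if r = y ∨ L = 2 ∧ r = y + unitVec μ then (J μ : ℂ) else 0) =
        (if r = y then (J μ : ℂ) else 0) + if r = y + unitVec μ then (J μ : ℂ) else 0 := by
      intro r
      by_cases h3 : r = y
      · subst h3; simp [ne_add_unitVec hL r μ]
      · simp [h3, h2]
    simp only [this, Finset.sum_ite_eq', Finset.mem_univ, if_true, Finset.sum_add_distrib, if_pos h2,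
      two_mul]
  · simp [h2]

theorem zWeight_cases {J : Fin d → ℝ} {hz : ℝ} {T : Finset (Site d L)} (h : zWeight J hz T ≠ 0) :
    (∃ r, T = {r}) ∨ ∃ r μ, T = {r, r + unitVec μ} := by
  by_contra! hcon
  refine h ?_
  simp [zWeight, hcon.1, hcon.2]

/-- The commutation equations between the Pauli coefficients of a conserved quantity. -/
theorem eqn_of_commute (hL : 2 ≤ L) {J : Fin d → ℝ} {hx hz : ℝ} {Q : Operator d L}
    (hQH : Commute Q (hamiltonian J hx hz)) {c : PauliString d L → ℂ}
    (hQ : Q = ∑ A, c A • pauliProduct A) (u v : Finset (Site d L)) :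
    (hx : ℂ) * ∑ t ∈ v, (if t ∈ u then 1 else -1) * c (strOf (u ∆ {t}) v) +
    ∑ T, (if (T ∩ u).card = 1 then zWeight J hz T * (if Disjoint (T ∩ u) v then 1 else -1) *
      c (strOf u (v ∆ T)) else 0) = 0 := by
  set B := pauliProduct (strOf u v) with hB
  set N := (2 : ℂ) ^ Fintype.card (Site d L) with hN
  -- The functional `tr (Q ·)` reads off Pauli coefficients up to the factor `N`, and by cyclicity
  -- `tr (Q [H, B]) = tr ([Q, H] B) = 0`.
  let φ : Operator d L →ₗ[ℂ] ℂ :=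
    (Matrix.traceLinearMap _ ℂ ℂ).comp (LinearMap.mulLeft ℂ Q)
  have hφ : ∀ A, φ (pauliProduct A) = N * c A := fun A => by
    change (Q * pauliProduct A).trace = _
    rw [hQ, trace_sum_mul_pauliProduct]
  have h0 : φ (hamiltonian J hx hz * B - B * hamiltonian J hx hz) = 0 := by
    change (Q * (hamiltonian J hx hz * B - B * hamiltonian J hx hz)).trace = 0
    rw [mul_sub, Matrix.trace_sub, ← mul_assoc, hQH.eq, ← mul_assoc, mul_assoc,
      Matrix.trace_mul_comm (hamiltonian J hx hz), sub_self]
  have h1 : hamiltonian J hx hz * B - B * hamiltonian J hx hz = ∑ r : Site d L,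
      ((∑ μ : Fin d, (J μ : ℂ) • ((2 * Complex.I * zSign u v {r, r + unitVec μ}) •
        pauliProduct (strOf u (v ∆ {r, r + unitVec μ})))) +
      (hx : ℂ) • ((2 * Complex.I * if r ∈ v then if r ∈ u then 1 else -1 else 0) •
        pauliProduct (strOf (u ∆ {r}) v)) +
      (hz : ℂ) • ((2 * Complex.I * zSign u v {r}) • pauliProduct (strOf u (v ∆ {r})))) := by
    rw [hamiltonian, Finset.sum_mul, Finset.mul_sum, ← Finset.sum_sub_distrib]
    refine Finset.sum_congr rfl fun r _ => ?_
    rw [← commutator_X, ← commutator_Z]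
    simp only [← commutator_ZZ u v (ne_add_unitVec hL r _), add_mul, mul_add, Finset.sum_mul,
      Finset.mul_sum, smul_mul_assoc, mul_smul_comm, smul_sub, Finset.sum_sub_distrib, ← hB]
    abel
  rw [h1] at h0
  simp only [map_sum, map_add, map_smul, hφ, smul_eq_mul] at h0
  have h2 : 2 * Complex.I * N ≠ 0 := by simp [hN]
  refine mul_left_cancel₀ h2 ?_
  rw [mul_zero]
  refine Eq.trans ?_ h0
  have h3 : ∑ T, (if (T ∩ u).card = 1 then zWeight J hz T *
      (if Disjoint (T ∩ u) v then 1 else -1) * c (strOf u (v ∆ T)) else 0) =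
      ∑ T, zWeight J hz T • (zSign u v T * c (strOf u (v ∆ T))) := by
    refine Finset.sum_congr rfl fun T _ => ?_
    rw [zSign, smul_eq_mul]
    split_ifs <;> ring
  have h4 : ∑ t ∈ v, (if t ∈ u then 1 else -1) * c (strOf (u ∆ {t}) v) =
      ∑ t, (if t ∈ v then if t ∈ u then 1 else -1 else 0) * c (strOf (u ∆ {t}) v) := by
    simp only [ite_mul _ _ (0 : ℂ), zero_mul, Finset.sum_ite_mem, Finset.univ_inter]
  rw [h3, h4, sum_zWeight_smul, Finset.mul_sum, ← Finset.sum_add_distrib, Finset.mul_sum]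
  refine Finset.sum_congr rfl fun r _ => ?_
  simp only [smul_eq_mul]
  have h5 : ∑ μ : Fin d, (J μ : ℂ) * (2 * Complex.I * zSign u v {r, r + unitVec μ} *
      (N * c (strOf u (v ∆ {r, r + unitVec μ})))) = 2 * Complex.I * N * ∑ μ : Fin d, (J μ : ℂ) *
        (zSign u v {r, r + unitVec μ} * c (strOf u (v ∆ {r, r + unitVec μ}))) := by
    rw [Finset.mul_sum]
    exact Finset.sum_congr rfl fun μ _ => by ring
  rw [h5]
  ring

/-- The sites carrying `X` or `Y`. -/
def PauliString.xSet (A : PauliString d L) : Finset (Site d L) :=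
  Finset.univ.filter fun t => A t = Pauli.X ∨ A t = Pauli.Y

/-- The sites carrying `Y` or `Z`. -/
def PauliString.zSet (A : PauliString d L) : Finset (Site d L) :=
  Finset.univ.filter fun t => A t = Pauli.Y ∨ A t = Pauli.Z

theorem mem_xSet {A : PauliString d L} {t : Site d L} :
    t ∈ A.xSet ↔ A t = Pauli.X ∨ A t = Pauli.Y := by
  simp [PauliString.xSet]

theorem mem_zSet {A : PauliString d L} {t : Site d L} :
    t ∈ A.zSet ↔ A t = Pauli.Y ∨ A t = Pauli.Z := by
  simp [PauliString.zSet]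

theorem strOf_xSet_zSet (A : PauliString d L) : strOf A.xSet A.zSet = A := by
  ext t
  simp only [strOf, mem_xSet, mem_zSet]
  cases A t <;> simp

theorem xSet_strOf (u v : Finset (Site d L)) : (strOf u v).xSet = u := by
  ext t
  simp only [mem_xSet, strOf]
  split_ifs <;> simp [*]

theorem zSet_strOf (u v : Finset (Site d L)) : (strOf u v).zSet = v := by
  ext t
  simp only [mem_zSet, strOf]
  split_ifs <;> simp [*]

theorem support_strOf {d L : ℕ} (u v : Finset (Site d L)) : (strOf u v).support = ↑(u ∪ v) := by
  ext t
  change strOf u v t ≠ Pauli.I ↔ t ∈ u ∪ v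
  simp only [strOf, Finset.mem_union]
  split_ifs <;> simp [*]

theorem sum_strOf {M : Type*} [AddCommMonoid M] (f : PauliString d L → M) :
    ∑ A, f A = ∑ u, ∑ v, f (strOf u v) := by
  rw [← Fintype.sum_prod_type']
  let φ : Finset (Site d L) × Finset (Site d L) ≃ PauliString d L :=
    { toFun := fun p => strOf p.1 p.2
      invFun := fun A => (A.xSet, A.zSet)
      left_inv := fun p => Prod.ext (xSet_strOf _ _) (zSet_strOf _ _)
      right_inv := strOf_xSet_zSet }
  exact (φ.sum_comp f).symm

/-- The Pauli coefficients of the Hamiltonian. -/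
noncomputable def hamCoeff (J : Fin d → ℝ) (hx hz : ℝ) (A : PauliString d L) : ℂ :=
  (if A.xSet = ∅ then zWeight J hz A.zSet else 0) +
    ∑ r, if A.xSet = {r} then if A.zSet = ∅ then (hx : ℂ) else 0 else 0

theorem strOf_empty {d L : ℕ} : strOf ∅ ∅ = fun _ : Site d L => Pauli.I := by
  ext t; simp [strOf]

theorem onSite_X (r : Site d L) : onSite Pauli.X r = pauliProduct (strOf {r} ∅) := by
  have := onSite_X_mul ∅ ∅ r
  rw [strOf_empty, pauliProduct_one, mul_one, ← Finset.bot_eq_empty, bot_symmDiff] at this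
  simpa using this

theorem onSite_Z (r : Site d L) : onSite Pauli.Z r = pauliProduct (strOf ∅ {r}) := by
  have := onSite_Z_mul ∅ ∅ r
  rw [strOf_empty, pauliProduct_one, mul_one, ← Finset.bot_eq_empty, bot_symmDiff] at this
  simpa using this

theorem onSite_Z_mul_onSite_Z {r t : Site d L} (h : r ≠ t) :
    onSite Pauli.Z r * onSite Pauli.Z t = pauliProduct (strOf ∅ {r, t}) := by
  have := onSite_Z_mul ∅ {t} r
  rw [← onSite_Z, symmDiff_comm, ← pair_eq_symmDiff h] at this
  simpa using this

theorem hamiltonian_eq_sum (hL : 2 ≤ L) (J : Fin d → ℝ) (hx hz : ℝ) :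
    (hamiltonian J hx hz : Operator d L) = ∑ A, hamCoeff J hx hz A • pauliProduct A := by
  rw [sum_strOf]
  simp only [hamCoeff, xSet_strOf, zSet_strOf, add_smul, Finset.sum_add_distrib, ite_smul,
    zero_smul, Finset.sum_smul]
  have h1 : ∑ u : Finset (Site d L), ∑ v : Finset (Site d L),
      (if u = ∅ then zWeight J hz v • pauliProduct (strOf u v) else 0) =
      ∑ v, zWeight J hz v • pauliProduct (strOf ∅ v) := by
    rw [Finset.sum_comm]; simp
  have h2 : ∑ u : Finset (Site d L), ∑ v : Finset (Site d L), ∑ r : Site d L,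
      (if u = {r} then if v = ∅ then (hx : ℂ) • pauliProduct (strOf u v) else 0 else 0) =
      ∑ r : Site d L, (hx : ℂ) • pauliProduct (strOf {r} ∅) := by
    have : ∀ u : Finset (Site d L), ∑ v : Finset (Site d L), ∑ r : Site d L,
      (if u = {r} then if v = ∅ then (hx : ℂ) • pauliProduct (strOf u v) else 0 else 0) =
        ∑ r : Site d L, if u = {r} then (hx : ℂ) • pauliProduct (strOf u ∅) else 0 := by
      intro u
      rw [Finset.sum_comm]
      refine Finset.sum_congr rfl fun r _ => ?_
      by_cases h : u = {r} <;> simp [h]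
    simp only [this]
    rw [Finset.sum_comm]
    simp
  rw [h1, h2, sum_zWeight_smul, ← Finset.sum_add_distrib, hamiltonian]
  refine Finset.sum_congr rfl fun r _ => ?_
  simp only [onSite_Z_mul_onSite_Z (ne_add_unitVec hL r _)]
  rw [onSite_X, onSite_Z]
  abel

theorem hamCoeff_cases {J : Fin d → ℝ} {hx hz : ℝ} {A : PauliString d L}
    (h : hamCoeff J hx hz A ≠ 0) :
    ∃ r s : Site d L, (s = r ∨ ∃ ν, s = r + unitVec ν) ∧ A.xSet ∪ A.zSet ⊆ {r, s} := by
  rw [hamCoeff] at h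
  generalize A.xSet = u at h ⊢
  generalize A.zSet = v at h ⊢
  by_cases hu : u = ∅
  · subst hu
    have hs : ∀ r : Site d L, (∅ : Finset (Site d L)) ≠ {r} := fun r h => by
      have := congrArg Finset.card h; simp at this
    simp only [if_true, hs, if_false, Finset.sum_const_zero, add_zero] at h
    rcases zWeight_cases h with ⟨r, rfl⟩ | ⟨r, μ, rfl⟩
    · exact ⟨r, r, Or.inl rfl, by simp⟩
    · exact ⟨r, _, Or.inr ⟨μ, rfl⟩, by simp⟩
  · rw [if_neg hu, zero_add] at h
    obtain ⟨r, -, hr⟩ := Finset.exists_ne_zero_of_sum_ne_zero h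
    by_cases h1 : u = {r}
    · by_cases h2 : v = ∅
      · subst h1 h2
        exact ⟨r, r, Or.inl rfl, by simp⟩
      · simp [h2] at hr
    · simp [h1] at hr

end Hamiltonian

/-! ### From local conserved quantities to the layered equations, and the theorem. -/

section Final

variable {d L : ℕ} [NeZero L]

theorem support_eq (A : PauliString d L) : A.support = ↑(A.xSet ∪ A.zSet) := by
  rw [← support_strOf, strOf_xSet_zSet]

theorem exists_width_of_isSupport {ℓ : Fin d → ℕ} {A : PauliString d L} (h : IsSupport ℓ A)
    {μ : Fin d} {k : ℕ} (hk : ℓ μ ≤ k) :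
    ∃ x₀ : ZMod L, ∀ t ∈ A.xSet ∪ A.zSet, ∃ j : ℕ, j < k ∧ t μ = x₀ + j := by
  obtain ⟨-, r, hr⟩ := h.1
  refine ⟨r μ, fun t ht => ?_⟩
  obtain ⟨j, hj, hjl⟩ := hr (by rw [support_eq]; exact ht : t ∈ A.support) μ
  exact ⟨j, by omega, hjl⟩

/-- Replacing only the side in direction `μ` of the minimal cuboid still gives a cuboid containing
the support, and minimality of `ℓ` holds componentwise. -/
theorem IsSupport.le_of_width {ℓ : Fin d → ℕ} {A : PauliString d L} (h : IsSupport ℓ A)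
    {μ : Fin d} {m : ℕ} (hm : 1 ≤ m)
    (hA : ∃ x₀ : ZMod L, ∀ t ∈ A.xSet ∪ A.zSet, ∃ j : ℕ, j < m ∧ t μ = x₀ + j) : ℓ μ ≤ m := by
  obtain ⟨hℓ, r, hr⟩ := h.1
  obtain ⟨x, hx⟩ := hA
  have := h.2 (show Function.update ℓ μ m ∈ _ from
    ⟨fun ν => by
      by_cases hν : ν = μ
      · subst hν; simpa using hm
      · simpa [hν] using hℓ ν,
    Function.update r μ x, fun t ht ν => by
      by_cases hν : ν = μ
      · subst hν
        rw [support_eq] at ht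
        simpa using hx t ht
      · simpa [hν] using hr ht ν⟩) μ
  simpa using this

/-- The layers are the level sets of the coordinate `μ`: bonds in direction `μ` join consecutive
layers, and all other bonds lie inside a layer. -/
theorem layeredSolution {k : ℕ} (hk : 1 ≤ k) (hkL : 2 * k ≤ L) {J : Fin d → ℝ} {hx hz : ℝ}
    (hJ : ∀ μ, J μ ≠ 0) (hhx : hx ≠ 0) (μ : Fin d) {Q : Operator d L}
    (hQH : Commute Q (hamiltonian J hx hz)) {c : PauliString d L → ℂ}
    (hQ : Q = ∑ A, c A • pauliProduct A)
    (hc : ∀ A, c A ≠ 0 → ∃ x₀ : ZMod L, ∀ t ∈ A.xSet ∪ A.zSet,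
      ∃ j : ℕ, j < k ∧ t μ = x₀ + j) :
    LayeredSolution (Pi.evalAddMonoidHom (fun _ : Fin d => ZMod L) μ) (unitVec μ)
      ((if L = 2 then 2 else 1) * (J μ : ℂ)) (hx : ℂ) (zWeight J hz) k
      (fun u v => c (strOf u v)) where
  hx_ne := by exact_mod_cast hhx
  J_ne := by
    refine mul_ne_zero ?_ (by exact_mod_cast hJ μ)
    split_ifs <;> simp
  lay_e := unitVec_apply_self μ
  nsmul_e := by ext ν; simp
  w_cases T hT := by
    rcases zWeight_cases hT with h | ⟨r, ν, rfl⟩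
    · exact Or.inl h
    · by_cases hν : ν = μ
      · subst hν; exact Or.inr (Or.inl ⟨r, rfl⟩)
      · refine Or.inr (Or.inr ⟨r, r + unitVec ν, ne_add_unitVec (by omega) r ν, ?_, rfl⟩)
        simp [unitVec_apply_of_ne (Ne.symm hν)]
  w_bond t := zWeight_bond (by omega) J hz t μ
  eqn u v := eqn_of_commute (by omega) hQH hQ u v
  width u v h := by
    have := hc _ h
    rw [xSet_strOf, zSet_strOf] at this
    exact this
  k_pos := hk
  two_k_le := hkL

theorem zWeight_bond_ne_zero (hL : 2 ≤ L) {J : Fin d → ℝ} (hz : ℝ) {μ : Fin d} (hJ : J μ ≠ 0)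
    (y : Site d L) : zWeight J hz {y, y + unitVec μ} ≠ 0 := by
  rw [zWeight_bond hL]
  refine mul_ne_zero ?_ (by exact_mod_cast hJ)
  split_ifs <;> simp

/-- The unit translations generate the lattice. -/
theorem eq_of_add_unitVec {f : Site d L → ℂ} (h : ∀ y μ, f (y + unitVec μ) = f y) (y : Site d L) :
    f y = f 0 := by
  have h1 : ∀ (n : ℕ) (y : Site d L) (μ : Fin d), f (y + n • unitVec μ) = f y := by
    intro n
    induction n with
    | zero => simp
    | succ n ih => intro y μ; rw [succ_nsmul, ← add_assoc, h, ih]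
  have h2 : ∀ s : Finset (Fin d), f (∑ μ ∈ s, (y μ).val • unitVec μ) = f 0 := by
    intro s
    induction s using Finset.induction_on with
    | empty => simp
    | insert μ s hμ ih => rw [Finset.sum_insert hμ, add_comm, h1, ih]
  have h3 : y = ∑ μ, (y μ).val • (unitVec μ : Site d L) := by
    ext ν
    rw [Finset.sum_apply, Finset.sum_eq_single ν]
    · simp [unitVec_apply_self]
    · intro μ _ hμ; simp [unitVec_apply_of_ne (Ne.symm hμ)]
    · simp
  conv_lhs => rw [h3]
  exact h2 _

theorem hamCoeff_width (J : Fin d → ℝ) (hx hz : ℝ) (μ : Fin d) (A : PauliString d L)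
    (h : hamCoeff J hx hz A ≠ 0) :
    ∃ x₀ : ZMod L, ∀ t ∈ A.xSet ∪ A.zSet, ∃ j : ℕ, j < 2 ∧ t μ = x₀ + j := by
  obtain ⟨r, s, hs, hA⟩ := hamCoeff_cases h
  refine ⟨r μ, fun t ht => ?_⟩
  rcases (by simpa using hA ht : t = r ∨ t = s) with rfl | rfl
  · exact ⟨0, by omega, by simp⟩
  · rcases hs with rfl | ⟨ν, rfl⟩
    · exact ⟨0, by omega, by simp⟩
    · by_cases hν : ν = μ
      · subst hν; exact ⟨1, by omega, by simp [unitVec_apply_self]⟩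
      · exact ⟨0, by omega, by simp [unitVec_apply_of_ne (Ne.symm hν)]⟩

theorem hamCoeff_X (J : Fin d → ℝ) (hx hz : ℝ) (y : Site d L) :
    hamCoeff J hx hz (strOf {y} ∅) = hx := by
  simp [hamCoeff, xSet_strOf, zSet_strOf]

/-- A conserved quantity of width one is a multiple of the identity. -/
theorem eq_smul_one_of_width_one (hL : 2 ≤ L) {J : Fin d → ℝ} {hx hz : ℝ}
    (hJ : ∀ μ, J μ ≠ 0) (hhx : hx ≠ 0) (μ : Fin d) {Q : Operator d L}
    (hQH : Commute Q (hamiltonian J hx hz)) {c : PauliString d L → ℂ}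
    (hQ : Q = ∑ A, c A • pauliProduct A)
    (hc : ∀ A, c A ≠ 0 → ∃ x₀ : ZMod L, ∀ t ∈ A.xSet ∪ A.zSet,
      ∃ j : ℕ, j < 1 ∧ t μ = x₀ + j) :
    ∃ b : ℂ, Q = b • 1 := by
  have S := layeredSolution le_rfl (by omega) hJ hhx μ hQH hQ hc
  refine ⟨c (strOf ∅ ∅), ?_⟩
  rw [hQ, Finset.sum_eq_single (strOf ∅ ∅), strOf_empty, pauliProduct_one]
  · intro A _ hA
    rw [← strOf_xSet_zSet A] at hA ⊢
    have h := S.eq_zero_of_width_one (u := A.xSet) (v := A.zSet) (by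
      by_contra! h
      rw [h.1, h.2] at hA
      exact hA rfl)
    rw [h, zero_smul]
  · simp

/-- The Hamiltonian is a `(2, …, 2)`-local conserved quantity. -/
theorem isLocalConserved_hamiltonian (hL : 2 ≤ L) {J : Fin d → ℝ} (hJ : ∀ μ, J μ ≠ 0)
    (hx hz : ℝ) :
    IsLocalConserved (hamiltonian J hx hz) (fun _ => 2)
      (hamiltonian J hx hz : Operator d L) := by
  refine ⟨Commute.refl _, hamCoeff J hx hz, hamiltonian_eq_sum hL J hx hz, fun μ => ⟨?_, ?_⟩⟩
  · set A : PauliString d L := strOf ∅ {0, 0 + unitVec μ} with hA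
    have hc : hamCoeff J hx hz A ≠ 0 := by
      have hs : ∀ r : Site d L, (∅ : Finset (Site d L)) ≠ {r} := fun r h => by
        have := congrArg Finset.card h; simp at this
      simp only [hamCoeff, hA, xSet_strOf, zSet_strOf, if_true, hs, if_false,
        Finset.sum_const_zero, add_zero]
      exact zWeight_bond_ne_zero hL hz (hJ μ) 0
    obtain ⟨ℓ, hℓ, -⟩ := existsUnique_isSupport A
    refine ⟨A, ℓ, hc, hℓ, le_antisymm
      (hℓ.le_of_width one_le_two (hamCoeff_width J hx hz μ A hc)) ?_⟩
    change 2 ≤ ℓ μ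
    by_contra hlt
    obtain ⟨x, hx'⟩ := exists_width_of_isSupport hℓ (μ := μ) (k := 1) (by omega)
    rw [hA, xSet_strOf, zSet_strOf] at hx'
    obtain ⟨i, hi, h0⟩ := hx' 0 (by simp)
    obtain ⟨j, hj, h1⟩ := hx' (0 + unitVec μ) (by simp)
    obtain rfl : i = 0 := by omega
    obtain rfl : j = 0 := by omega
    rw [Pi.add_apply, unitVec_apply_self, h0.symm] at h1
    exact one_ne_zero_of_two_le hL (by simpa using h1)
  · rintro m ⟨A, ℓ, hc, hℓ, rfl⟩
    exact hℓ.le_of_width one_le_two (hamCoeff_width J hx hz μ A hc)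

/-- A conserved quantity of width at most two is a combination of `H` and the identity. -/
theorem eq_hamiltonian_of_width_two (hL : 4 ≤ L) {J : Fin d → ℝ} {hx hz : ℝ}
    (hJ : ∀ μ, J μ ≠ 0) (hhx : hx ≠ 0) {μ ν : Fin d} (hμν : ν ≠ μ) {Q : Operator d L}
    (hQH : Commute Q (hamiltonian J hx hz)) {c : PauliString d L → ℂ}
    (hQ : Q = ∑ A, c A • pauliProduct A)
    (hc : ∀ A, c A ≠ 0 → ∃ x₀ : ZMod L, ∀ t ∈ A.xSet ∪ A.zSet,
      ∃ j : ℕ, j < 2 ∧ t μ = x₀ + j) :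
    ∃ a b : ℂ, Q = a • hamiltonian J hx hz + b • 1 := by
  -- Chosen so that `Q - a • H` has no `X` term on site `0`, and hence, the single-`X` coefficients
  -- being translation invariant, on no site.
  set a : ℂ := c (strOf {0} ∅) / hx with ha
  have hhx' : (hx : ℂ) ≠ 0 := by exact_mod_cast hhx
  set Q' : Operator d L := Q - a • hamiltonian J hx hz with hQ'
  set c' : PauliString d L → ℂ := fun A => c A - a * hamCoeff J hx hz A with hc'
  have hcomm : Commute Q' (hamiltonian J hx hz) :=
    hQH.sub_left ((Commute.refl _).smul_left a)
  have hsum : Q' = ∑ A, c' A • pauliProduct A := by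
    rw [hQ']
    nth_rewrite 1 [hQ]
    rw [hamiltonian_eq_sum (by omega) J hx hz, Finset.smul_sum, ← Finset.sum_sub_distrib]
    exact Finset.sum_congr rfl fun A _ => by rw [hc', sub_smul, mul_smul]
  have hw : ∀ A, c' A ≠ 0 → ∃ x₀ : ZMod L, ∀ t ∈ A.xSet ∪ A.zSet,
      ∃ j : ℕ, j < 2 ∧ t μ = x₀ + j := by
    intro A hA
    by_cases h : c A = 0
    · refine hamCoeff_width J hx hz μ A fun h' => hA ?_
      rw [hc']; simp only [h, h', mul_zero, sub_zero]
    · exact hc A h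
  have S := layeredSolution one_le_two (by omega) hJ hhx μ hcomm hsum hw
  have hE := S.endFree le_rfl (g := unitVec ν) (unitVec_apply_of_ne hμν.symm)
    (unitVec_ne_zero (by omega) ν) (zWeight_bond_ne_zero (by omega) hz (hJ ν))
  have hX : ∀ y, c' (strOf {y} ∅) = 0 := by
    intro y
    rw [eq_of_add_unitVec (f := fun y => c' (strOf {y} ∅)) (fun y ι => ?_) y]
    · simp only [hc', hamCoeff_X, ha]
      field_simp
      ring
    · by_cases hι : ι = μ
      · subst hι; exact S.coeff_X_add hE y
      · exact S.coeff_X_add_offset hE (unitVec_ne_zero (by omega) ι)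
          (zWeight_bond_ne_zero (by omega) hz (hJ ι) y)
  obtain ⟨b, hb⟩ := eq_smul_one_of_width_one (by omega) hJ hhx μ hcomm hsum (fun A hA => by
    rw [← strOf_xSet_zSet A] at hA
    exact S.narrow_of_two hE hX hA)
  exact ⟨a, b, by rw [← hb, hQ']; abel⟩

end Final

end IsingLattice

theorem mainTheorem1 (d L : ℕ) [NeZero L] (hd : 2 ≤ d)
    (J : Fin d → ℝ) (hx hz : ℝ) (hJ : ∀ μ, J μ ≠ 0) (hhx : hx ≠ 0)
    (k : Fin d → ℕ) (hk : ∀ μ, 1 ≤ k μ ∧ k μ ≤ L)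
    (μs : Fin d) (hμs : (k μs : ℝ) ≤ (L : ℝ) / 2) :
    (3 ≤ k μs → ¬ ∃ Q : IsingLattice.Operator d L,
        IsingLattice.IsLocalConserved (IsingLattice.hamiltonian J hx hz) k Q) ∧
    (k μs ≤ 2 → ∀ Q : IsingLattice.Operator d L,
        IsingLattice.IsLocalConserved (IsingLattice.hamiltonian J hx hz) k Q →
          ∃ a b : ℂ, Q = a • IsingLattice.hamiltonian J hx hz + b • 1) ∧
    IsingLattice.IsLocalConserved (IsingLattice.hamiltonian J hx hz) (fun _ => 2)
      (IsingLattice.hamiltonian (d := d) (L := L) J hx hz) := by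
  open IsingLattice in
  have hkL : 2 * k μs ≤ L := by
    have : (2 * k μs : ℝ) ≤ L := by linarith
    exact_mod_cast this
  have hk1 := (hk μs).1
  have hwidth : ∀ {c : PauliString d L → ℂ}, IsGreatest {m : ℕ | ∃ (A : PauliString d L)
      (ℓ : Fin d → ℕ), c A ≠ 0 ∧ IsSupport ℓ A ∧ ℓ μs = m} (k μs) →
      ∀ A, c A ≠ 0 → ∃ x₀ : ZMod L, ∀ t ∈ A.xSet ∪ A.zSet,
        ∃ j : ℕ, j < k μs ∧ t μs = x₀ + j := fun hg A hA => by
    obtain ⟨ℓ, hℓ, -⟩ := existsUnique_isSupport A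
    exact exists_width_of_isSupport hℓ (hg.2 ⟨A, ℓ, hA, hℓ, rfl⟩)
  obtain ⟨ν, hν⟩ : ∃ ν : Fin d, ν ≠ μs := by
    have : Nontrivial (Fin d) := Fin.nontrivial_iff_two_le.2 hd
    exact exists_ne μs
  refine ⟨?_, ?_, isLocalConserved_hamiltonian (by omega) hJ hx hz⟩
  · rintro h3 ⟨Q, hQH, c, hQ, hg⟩
    have S := layeredSolution hk1 hkL hJ hhx μs hQH hQ (hwidth (hg μs))
    -- This string attains the maximal side length, yet every string with nonzero coefficient fits
    -- into `k μs - 1` layers.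
    obtain ⟨A, ℓ, hA, hℓ, hℓk⟩ := (hg μs).1
    have hA' : c (strOf A.xSet A.zSet) ≠ 0 := by rwa [strOf_xSet_zSet]
    have := hℓ.le_of_width (μ := μs) (m := k μs - 1) (by omega)
      (S.narrow_of_three_le h3 (g := unitVec ν) (unitVec_apply_of_ne hν.symm)
        (unitVec_ne_zero (by omega) ν) (zWeight_bond_ne_zero (by omega) hz (hJ ν)) hA')
    omega
  · rintro h2 Q ⟨hQH, c, hQ, hg⟩
    rcases (by omega : k μs = 1 ∨ k μs = 2) with h | h
    · obtain ⟨b, hb⟩ := eq_smul_one_of_width_one (by omega) hJ hhx μs hQH hQ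
        (by simpa only [h] using hwidth (hg μs))
      exact ⟨0, b, by rw [hb, zero_smul, zero_add]⟩
    · exact eq_hamiltonian_of_width_two (by omega) hJ hhx hν hQH hQ
        (by simpa only [h] using hwidth (hg μs))
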